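/- Let $k,T\ge 1$, and let $k$ subsystems with $\mathbb R^n$-valued states $x^i_t$ and $\mathbb R^m$-valued controls $u^i_t$ obey $$x^i_{t+1}=A_tx^i_t+B_tu^i_t+C_t\bar x_t+w^i_{t+1},\qquad 1\le i\le k,\ 0\le t<T,$$ where $\bar x_t=\frac1k\sum_{j=1}^k x^j_t$ is the mean-field and $A_t,C_t\in\mathbb R^{n\times n}$, $B_t\in\mathbb R^{n\times m}$. Write $\mathbf x_t=(x^1_t,\dots,x^k_t)$, and similarly $\mathbf u_t$, $\mathbf w_t$. Assume that $\mathbf x_0$ is deterministic, that $\mathbf w_1,\dots,\mathbf w_T$ are i.i.d., that $w^1_t,\dots,w^k_t$ are i.i.d. for each $t$, and that $\mathbb E\|w^i_t\|^4<\infty$. Let $\mathcal F_t=\sigma(\mathbf x_0,\dots,\mathbf x_t,\mathbf u_0,\dots,\mathbf u_{t-1})$, with $\mathcal F_{-1}$ trivial. A control $\mathbf u=(\mathbf u_0,\dots,\mathbf u_{T-1})$ is admissible if every $u^i_t$ is $\mathcal F_t$-measurable with $\mathbb E\|u^i_t\|^2<\infty$. Let $P_t,Q_t$ ($0\le t\le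 T$) be symmetric positive semidefinite, $R_t$ ($0\le t<T$) symmetric positive definite, $\lambda\ge 0$, and put $$\Delta^i_t={x^i_t}^\top Q_tx^i_t-\mathbb E\big({x^i_t}^\top Q_tx^i_t\,\big|\,\mathcal F_{t-1}\big),$$ $$J(\mathbf u)=\sum_{t=0}^{T}\sum_{i=1}^k\Big(\bar x_t^\top P_t\bar x_t+{x^i_t}^\top Q_tx^i_t+\lambda(\Delta^i_t)^2\Big)+\sum_{t=0}^{T-1}\sum_{i=1}^k{u^i_t}^\top R_tu^i_t .$$ Let $\mu=\mathbb E(w^i_t)$, $d=w^i_t-\mu$, $\Sigma=\mathbb E(dd^\top)$, $\gamma_t=\mathbb E(dd^\top Q_td)$, $Q^\lambda_t=4\lambda Q_t\Sigma Q_t$, $b^\lambda_t=4\lambda Q_t\gamma_t$, $\bar A_t=A_t+C_t$ and $\bar Q_t=P_t+Q_t$. Define backwards $S_T=Q_T+Q^\lambda_T$, $\bar S_T=\bar Q_T+Q^\lambda_T$, $g_T=b^\lambda_T$ and, for $0\le t<T$, $$S_t=-A_t^\top S_{t+1}B_t(R_t+B_t^\top S_{t+1}B_t)^{-1}B_t^\top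 S_{t+1}A_t+A_t^\top S_{t+1}A_t+Q_t+Q^\lambda_t,$$ $$\bar S_t=-\bar A_t^\top\bar S_{t+1}B_t(R_t+B_t^\top\bar S_{t+1}B_t)^{-1}B_t^\top\bar S_{t+1}\bar A_t+\bar A_t^\top\bar S_{t+1}\bar A_t+\bar Q_t+Q^\lambda_t,$$ $$K_t=-(R_t+B_t^\top S_{t+1}B_t)^{-1}B_t^\top S_{t+1}A_t,\qquad \bar K_t=-(R_t+B_t^\top\bar S_{t+1}B_t)^{-1}B_t^\top\bar S_{t+1}\bar A_t,$$ $$g_t=(\bar A_t+B_t\bar K_t)^\top(2\bar S_{t+1}\mu+g_{t+1})+b^\lambda_t,$$ $$f_t=-(R_t+B_t^\top\bar S_{t+1}B_t)^{-1}B_t^\top\big(\bar S_{t+1}\mu+\tfrac12g_{t+1}\big).$$ Then all the inverses above exist, $J(\mathbf u)$ is integrable for every admissible $\mathbf u$, and the problem of minimizing $\mathbb E(J(\mathbf u))$ over the admissible controls has a solution, unique up to almost sure equality, namely the control given by $$u^{i*}_t=K_tx^i_t+(\bar K_t-K_t)\bar x_t+f_t,\qquad 1\le i\le k,\ 0\le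 t<T,$$ where $x^i_t$ are the states generated by $\mathbf u^*$ itself. In particular, the optimal control of subsystem $i$ depends on the other subsystems only through the mean-field. -/

import Mathlib

open MeasureTheory ProbabilityTheory
open scoped Matrix

namespace MeanFieldLQ

noncomputable section

/-- Deterministic data of `k` mean-field coupled linear-quadratic subsystems with states in `ℝⁿ`
and controls in `ℝᵐ`: horizon, dynamics matrices, cost matrices, risk parameter and (deterministic)
initial states.  The matrices are used only at times `t < T` (`A`, `B`, `C`, `R`) and `t ≤ T`
(`P`, `Q`). -/
structure Data (k n m : ℕ) where
  T : ℕ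
  A : ℕ → Matrix (Fin n) (Fin n) ℝ
  B : ℕ → Matrix (Fin n) (Fin m) ℝ
  C : ℕ → Matrix (Fin n) (Fin n) ℝ
  P : ℕ → Matrix (Fin n) (Fin n) ℝ
  Q : ℕ → Matrix (Fin n) (Fin n) ℝ
  R : ℕ → Matrix (Fin m) (Fin m) ℝ
  lam : ℝ
  x0 : Fin k → Fin n → ℝ

/-- The quadratic form `vᵀ M v`. -/
def quad {n : ℕ} (M : Matrix (Fin n) (Fin n) ℝ) (v : Fin n → ℝ) : ℝ :=
  v ⬝ᵥ (M *ᵥ v)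

/-- The mean-field `(1/k) ∑ᵢ vⁱ` of `k` vectors. -/
def meanField {k n : ℕ} (v : Fin k → Fin n → ℝ) : Fin n → ℝ :=
  (k : ℝ)⁻¹ • ∑ i, v i

variable {k n m : ℕ} {Ω : Type*}

/-- The state process generated by the control `u` and the disturbance `w`:
`x₀` is given and `xⁱ_{t+1} = A_t xⁱ_t + B_t uⁱ_t + C_t x̄_t + wⁱ_{t+1}`. -/
def state (D : Data k n m) (w : ℕ → Ω → Fin k → Fin n → ℝ) (u : ℕ → Ω → Fin k → Fin m → ℝ) :
    ℕ → Ω → Fin k → Fin n → ℝ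
  | 0 => fun _ => D.x0
  | t + 1 => fun ω i =>
      D.A t *ᵥ state D w u t ω i + D.B t *ᵥ u t ω i
        + D.C t *ᵥ meanField (state D w u t ω) + w (t + 1) ω i

/-- The history `h_t = (x₀, …, x_t, u₀, …, u_{t-1})` of all the subsystems. -/
def history (D : Data k n m) (w : ℕ → Ω → Fin k → Fin n → ℝ) (u : ℕ → Ω → Fin k → Fin m → ℝ)
    (t : ℕ) (ω : Ω) : (Fin (t + 1) → Fin k → Fin n → ℝ) × (Fin t → Fin k → Fin m → ℝ) :=
  (fun s => state D w u s ω, fun s => u s ω)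

/-- The σ-algebra `F_t = σ(h_t)`. -/
@[reducible] def histSigma (D : Data k n m) (w : ℕ → Ω → Fin k → Fin n → ℝ) (u : ℕ → Ω → Fin k → Fin m → ℝ)
    (t : ℕ) : MeasurableSpace Ω :=
  MeasurableSpace.comap (history D w u t) inferInstance

/-- The σ-algebra `F_{t-1}`, where `F_{-1}` is the trivial σ-algebra. -/
@[reducible] def prevSigma (D : Data k n m) (w : ℕ → Ω → Fin k → Fin n → ℝ) (u : ℕ → Ω → Fin k → Fin m → ℝ) :
    ℕ → MeasurableSpace Ω
  | 0 => ⊥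
  | t + 1 => histSigma D w u t

/-- The standard state cost `∑ᵢ (x̄ᵀ P_t x̄ + xⁱᵀ Q_t xⁱ)`. -/
def stateCost (D : Data k n m) (t : ℕ) (x : Fin k → Fin n → ℝ) : ℝ :=
  ∑ i, (quad (D.P t) (meanField x) + quad (D.Q t) (x i))

/-- The standard control cost `∑ᵢ uⁱᵀ R_t uⁱ`. -/
def controlCost (D : Data k n m) (t : ℕ) (u : Fin k → Fin m → ℝ) : ℝ :=
  ∑ i, quad (D.R t) (u i)

variable [MeasurableSpace Ω]

/-- The state-energy prediction error `xⁱ_tᵀ Q_t xⁱ_t - E(xⁱ_tᵀ Q_t xⁱ_t | F_{t-1})`. -/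
def predError (prob : Measure Ω) (D : Data k n m) (w : ℕ → Ω → Fin k → Fin n → ℝ)
    (u : ℕ → Ω → Fin k → Fin m → ℝ) (t : ℕ) (i : Fin k) (ω : Ω) : ℝ :=
  quad (D.Q t) (state D w u t ω i)
    - (prob[fun ω' => quad (D.Q t) (state D w u t ω' i) | prevSigma D w u t]) ω

/-- The risk-aware cost `lam * ∑ᵢ (Δⁱ_t)²`. -/
def riskCost (prob : Measure Ω) (D : Data k n m) (w : ℕ → Ω → Fin k → Fin n → ℝ)
    (u : ℕ → Ω → Fin k → Fin m → ℝ) (t : ℕ) (ω : Ω) : ℝ :=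
  D.lam * ∑ i, (predError prob D w u t i ω) ^ 2

/-- The random total cost `J(u)`. -/
def totalCost (prob : Measure Ω) (D : Data k n m) (w : ℕ → Ω → Fin k → Fin n → ℝ)
    (u : ℕ → Ω → Fin k → Fin m → ℝ) (ω : Ω) : ℝ :=
  stateCost D D.T (state D w u D.T ω) + riskCost prob D w u D.T ω
    + ∑ t ∈ Finset.range D.T,
        (stateCost D t (state D w u t ω) + riskCost prob D w u t ω + controlCost D t (u t ω))

/-- Standing assumptions on the disturbances `w₁, …, w_T`, where `w t ω i` is the disturbance of
subsystem `i`: the stacked vectors are i.i.d. over time, at each time the disturbances of the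
subsystems are i.i.d., and the fourth moments `E‖wⁱ_t‖⁴` (Euclidean norm) are finite. -/
structure DisturbanceAssumption (prob : Measure Ω) (T : ℕ)
    (w : ℕ → Ω → Fin k → Fin n → ℝ) : Prop where
  measurable : ∀ t < T, Measurable (w (t + 1))
  indep_time : iIndepFun (fun t : Fin T => w (t + 1)) prob
  ident_time : ∀ s < T, ∀ t < T, IdentDistrib (w (s + 1)) (w (t + 1)) prob prob
  indep_sub : ∀ t < T, iIndepFun (fun (i : Fin k) ω => w (t + 1) ω i) prob
  ident_sub : ∀ t < T, ∀ i j : Fin k,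
    IdentDistrib (fun ω => w (t + 1) ω i) (fun ω => w (t + 1) ω j) prob prob
  fourth_moment : ∀ t < T, ∀ i : Fin k,
    Integrable (fun ω => (w (t + 1) ω i ⬝ᵥ w (t + 1) ω i) ^ 2) prob

/-- Admissible controls: every `uⁱ_t`, `t < T`, is `F_t`-measurable with `E‖uⁱ_t‖² < ∞`
(Euclidean norm). -/
def Admissible (prob : Measure Ω) (D : Data k n m) (w : ℕ → Ω → Fin k → Fin n → ℝ)
    (u : ℕ → Ω → Fin k → Fin m → ℝ) : Prop :=
  ∀ t < D.T, ∀ i : Fin k,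
    Measurable[histSigma D w u t] (fun ω => u t ω i) ∧
      Integrable (fun ω => u t ω i ⬝ᵥ u t ω i) prob

/-- `u` minimizes the expected total cost among the admissible controls. -/
def IsOptimal (prob : Measure Ω) (D : Data k n m) (w : ℕ → Ω → Fin k → Fin n → ℝ)
    (u : ℕ → Ω → Fin k → Fin m → ℝ) : Prop :=
  Admissible prob D w u ∧
    ∀ v : ℕ → Ω → Fin k → Fin m → ℝ, Admissible prob D w v →
      ∫ ω, totalCost prob D w u ω ∂prob ≤ ∫ ω, totalCost prob D w v ω ∂prob

/-- The mean `μ = E(ξ)`, taken coordinatewise. -/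
def noiseMean (prob : Measure Ω) (ξ : Ω → Fin n → ℝ) : Fin n → ℝ :=
  fun a => ∫ ω, ξ ω a ∂prob

/-- The covariance matrix `Σ = E(d dᵀ)`, where `d = ξ - μ`. -/
def noiseCov (prob : Measure Ω) (ξ : Ω → Fin n → ℝ) : Matrix (Fin n) (Fin n) ℝ :=
  Matrix.of fun a b =>
    ∫ ω, (ξ ω - noiseMean prob ξ) a * (ξ ω - noiseMean prob ξ) b ∂prob

/-- The skew vector `E(d dᵀ Q d)`, where `d = ξ - μ`. -/
def noiseSkew (prob : Measure Ω) (ξ : Ω → Fin n → ℝ) (Q : Matrix (Fin n) (Fin n) ℝ) :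
    Fin n → ℝ :=
  fun a => ∫ ω, (ξ ω - noiseMean prob ξ) a * quad Q (ξ ω - noiseMean prob ξ) ∂prob

/-- `Q_t^λ = 4 λ Q_t Σ Q_t`, for a disturbance distributed as `ξ`. -/
def Qlam (prob : Measure Ω) (D : Data k n m) (ξ : Ω → Fin n → ℝ) (t : ℕ) :
    Matrix (Fin n) (Fin n) ℝ :=
  (4 * D.lam) • (D.Q t * noiseCov prob ξ * D.Q t)

/-- `b_t^λ = 4 λ Q_t γ_t`, for a disturbance distributed as `ξ`. -/
def blam (prob : Measure Ω) (D : Data k n m) (ξ : Ω → Fin n → ℝ) (t : ℕ) : Fin n → ℝ :=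
  (4 * D.lam) • (D.Q t *ᵥ noiseSkew prob ξ (D.Q t))

/-- The matrix `R + Bᵀ S B` that the recursions invert. -/
def pivot (B : Matrix (Fin n) (Fin m) ℝ) (R : Matrix (Fin m) (Fin m) ℝ)
    (S : Matrix (Fin n) (Fin n) ℝ) : Matrix (Fin m) (Fin m) ℝ :=
  R + Bᵀ * S * B

/-- The feedback matrix `-(R + Bᵀ S B)⁻¹ Bᵀ S A`. -/
def gain (A : Matrix (Fin n) (Fin n) ℝ) (B : Matrix (Fin n) (Fin m) ℝ)
    (R : Matrix (Fin m) (Fin m) ℝ) (S : Matrix (Fin n) (Fin n) ℝ) : Matrix (Fin m) (Fin n) ℝ :=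
  -((pivot B R S)⁻¹ * Bᵀ * S * A)

/-- The backward Riccati recursion on `{0, …, T}`: `S_T = M_T` and
`S_t = -A_tᵀ S_{t+1} B_t (R_t + B_tᵀ S_{t+1} B_t)⁻¹ B_tᵀ S_{t+1} A_t + A_tᵀ S_{t+1} A_t + M_t`. -/
def riccati (T : ℕ) (A : ℕ → Matrix (Fin n) (Fin n) ℝ) (B : ℕ → Matrix (Fin n) (Fin m) ℝ)
    (M : ℕ → Matrix (Fin n) (Fin n) ℝ) (R : ℕ → Matrix (Fin m) (Fin m) ℝ) (t : ℕ) :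
    Matrix (Fin n) (Fin n) ℝ :=
  if t < T then
    -((A t)ᵀ * riccati T A B M R (t + 1) * B t
        * (pivot (B t) (R t) (riccati T A B M R (t + 1)))⁻¹
        * (B t)ᵀ * riccati T A B M R (t + 1) * A t)
      + (A t)ᵀ * riccati T A B M R (t + 1) * A t + M t
  else M T
termination_by T - t

/-- `S_t`: the Riccati recursion for `(A_t, Q_t + Q_t^λ)`. -/
def S (prob : Measure Ω) (D : Data k n m) (ξ : Ω → Fin n → ℝ) : ℕ → Matrix (Fin n) (Fin n) ℝ :=
  riccati D.T D.A D.B (fun t => D.Q t + Qlam prob D ξ t) D.R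

/-- `S̄_t`: the Riccati recursion for `(A_t + C_t, P_t + Q_t + Q_t^λ)`. -/
def Sbar (prob : Measure Ω) (D : Data k n m) (ξ : Ω → Fin n → ℝ) :
    ℕ → Matrix (Fin n) (Fin n) ℝ :=
  riccati D.T (fun t => D.A t + D.C t) D.B (fun t => D.P t + D.Q t + Qlam prob D ξ t) D.R

/-- `K_t = -(R_t + B_tᵀ S_{t+1} B_t)⁻¹ B_tᵀ S_{t+1} A_t`. -/
def K (prob : Measure Ω) (D : Data k n m) (ξ : Ω → Fin n → ℝ) (t : ℕ) :
    Matrix (Fin m) (Fin n) ℝ :=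
  gain (D.A t) (D.B t) (D.R t) (S prob D ξ (t + 1))

/-- `K̄_t = -(R_t + B_tᵀ S̄_{t+1} B_t)⁻¹ B_tᵀ S̄_{t+1} (A_t + C_t)`. -/
def Kbar (prob : Measure Ω) (D : Data k n m) (ξ : Ω → Fin n → ℝ) (t : ℕ) :
    Matrix (Fin m) (Fin n) ℝ :=
  gain (D.A t + D.C t) (D.B t) (D.R t) (Sbar prob D ξ (t + 1))

/-- The backward affine recursion: `g_T = b_T^λ` and
`g_t = (A_t + C_t + B_t K̄_t)ᵀ (2 S̄_{t+1} μ + g_{t+1}) + b_t^λ`. -/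
def g (prob : Measure Ω) (D : Data k n m) (ξ : Ω → Fin n → ℝ) (t : ℕ) : Fin n → ℝ :=
  if t < D.T then
    (D.A t + D.C t + D.B t * Kbar prob D ξ t)ᵀ *ᵥ
        ((2 : ℝ) • (Sbar prob D ξ (t + 1) *ᵥ noiseMean prob ξ) + g prob D ξ (t + 1))
      + blam prob D ξ t
  else blam prob D ξ D.T
termination_by D.T - t

/-- `f_t = -(R_t + B_tᵀ S̄_{t+1} B_t)⁻¹ B_tᵀ (S̄_{t+1} μ + g_{t+1} / 2)`. -/
def f (prob : Measure Ω) (D : Data k n m) (ξ : Ω → Fin n → ℝ) (t : ℕ) : Fin m → ℝ :=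
  -(((pivot (D.B t) (D.R t) (Sbar prob D ξ (t + 1)))⁻¹ * (D.B t)ᵀ) *ᵥ
      (Sbar prob D ξ (t + 1) *ᵥ noiseMean prob ξ + (1 / 2 : ℝ) • g prob D ξ (t + 1)))

end

end MeanFieldLQ

/-! The risk term only modifies the quadratic cost. The state `xⁱ_{t+1}` is `y + d`, where the drift
`y` is `F_t`-measurable and the centred disturbance `d` is independent of `F_t`. The prediction
error is therefore `2 yᵀQd + dᵀQd - E(dᵀQd)`, and its second moment is `4 E(yᵀQΣQy) + 4 E(γᵀQy)`
plus a constant (`integral_sq_sub_condExp`). Replacing `y` by `xⁱ_{t+1}` in this expression shifts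
it by another constant. Hence, up to a constant independent of the control, the expected cost is
that of a risk-neutral problem with `Q_t + Q^λ_t` in place of `Q_t` and the extra linear term
`b^λ_t` (`exists_integral_riskCost`).

The new problem splits into the deviations `xⁱ - x̄` and the mean-field `x̄`, because the cross
terms of a quadratic form sum to zero (`sum_quad_sub_meanField`). The coupling `C_t`, the noise mean
and the linear terms act on `x̄` alone. Completing the square (`complete_square`) yields `S, K` for
the deviations and `S̄, K̄, g, f` for the mean-field, hence a one-step identity
(`RiskAdjusted.dynamic_programming`) whose excess `gap` is nonnegative and vanishes exactly at the
feedback law.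

Telescoping gives `E J(u) = c + ∑ E gap_t` with the same `c` for every admissible `u`
(`exists_integral_totalCost`). The feedback attains `c`. A minimizer has almost surely zero gaps, so
it obeys the feedback law, and by induction on time its states are those of the closed loop.
Although `F_t` depends on the control, it always lies in `σ(w₁, …, w_t)`, which gives the
independence from `w_{t+1}` used throughout (`Admissible.indep_histSigma`). -/

namespace MeanFieldLQ

/-! ### Quadratic forms, completion of the square and the Riccati recursion -/

variable {k n m : ℕ}

theorem quad_add {M : Matrix (Fin n) (Fin n) ℝ} (hM : Mᵀ = M) (x y : Fin n → ℝ) :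
    quad M (x + y) = quad M x + 2 * (x ⬝ᵥ M *ᵥ y) + quad M y := by
  have h : y ⬝ᵥ M *ᵥ x = x ⬝ᵥ M *ᵥ y := by
    rw [Matrix.dotProduct_mulVec, ← Matrix.mulVec_transpose, hM, dotProduct_comm]
  simp only [quad, Matrix.mulVec_add, dotProduct_add, add_dotProduct, h]
  ring

theorem quad_neg (M : Matrix (Fin n) (Fin n) ℝ) (x : Fin n → ℝ) : quad M (-x) = quad M x := by
  simp [quad, Matrix.mulVec_neg]

theorem quad_add_left (M N : Matrix (Fin n) (Fin n) ℝ) (x : Fin n → ℝ) :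
    quad (M + N) x = quad M x + quad N x := by
  simp [quad, Matrix.add_mulVec, dotProduct_add]

theorem quad_sub_left (M N : Matrix (Fin n) (Fin n) ℝ) (x : Fin n → ℝ) :
    quad (M - N) x = quad M x - quad N x := by
  simp [quad, Matrix.sub_mulVec, dotProduct_sub]

theorem quad_neg_left (M : Matrix (Fin n) (Fin n) ℝ) (x : Fin n → ℝ) :
    quad (-M) x = -quad M x := by
  simp [quad, Matrix.neg_mulVec, dotProduct_neg]

theorem quad_mulVec (M : Matrix (Fin n) (Fin n) ℝ) (A : Matrix (Fin n) (Fin m) ℝ)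
    (x : Fin m → ℝ) : quad M (A *ᵥ x) = quad (Aᵀ * M * A) x := by
  simp only [quad, ← Matrix.mulVec_mulVec]
  rw [Matrix.dotProduct_mulVec x Aᵀ, Matrix.vecMul_transpose]

theorem quad_eq_sum (M : Matrix (Fin n) (Fin n) ℝ) (x : Fin n → ℝ) :
    quad M x = ∑ a, ∑ b, M a b * (x a * x b) := by
  simp only [quad, dotProduct, Matrix.mulVec, Finset.mul_sum]
  exact Finset.sum_congr rfl fun a _ => Finset.sum_congr rfl fun b _ => by ring

theorem quad_nonneg {M : Matrix (Fin n) (Fin n) ℝ} (hM : M.PosSemidef) (x : Fin n → ℝ) :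
    0 ≤ quad M x := by
  simpa [quad] using hM.dotProduct_mulVec_nonneg x

theorem eq_zero_of_quad_eq_zero {M : Matrix (Fin n) (Fin n) ℝ} (hM : M.PosDef) {x : Fin n → ℝ}
    (h : quad M x = 0) : x = 0 := by
  by_contra hx
  have := hM.dotProduct_mulVec_pos hx
  simp only [star_trivial] at this
  exact this.ne' h

theorem transpose_eq_of_posSemidef {M : Matrix (Fin n) (Fin n) ℝ} (hM : M.PosSemidef) :
    Mᵀ = M := by
  simpa [Matrix.conjTranspose_eq_transpose_of_trivial] using hM.isHermitian.eq

theorem posDef_pivot {B : Matrix (Fin n) (Fin m) ℝ} {R : Matrix (Fin m) (Fin m) ℝ}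
    {S : Matrix (Fin n) (Fin n) ℝ} (hR : R.PosDef) (hS : S.PosSemidef) :
    (pivot B R S).PosDef := by
  have := hS.conjTranspose_mul_mul_same B
  rw [Matrix.conjTranspose_eq_transpose_of_trivial] at this
  exact hR.add_posSemidef this

/-- One step of the Riccati recursion. -/
noncomputable def riccatiStep (A : Matrix (Fin n) (Fin n) ℝ) (B : Matrix (Fin n) (Fin m) ℝ)
    (M : Matrix (Fin n) (Fin n) ℝ) (R : Matrix (Fin m) (Fin m) ℝ)
    (S : Matrix (Fin n) (Fin n) ℝ) : Matrix (Fin n) (Fin n) ℝ :=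
  -(Aᵀ * S * B * (pivot B R S)⁻¹ * Bᵀ * S * A) + Aᵀ * S * A + M

/-- Completing the square in the control variable `u` for a quadratic stage cost and an affine
quadratic cost-to-go. -/
theorem complete_square {A : Matrix (Fin n) (Fin n) ℝ} {B : Matrix (Fin n) (Fin m) ℝ}
    {M : Matrix (Fin n) (Fin n) ℝ} {R : Matrix (Fin m) (Fin m) ℝ} {S : Matrix (Fin n) (Fin n) ℝ}
    (hR : R.PosDef) (hS : S.PosSemidef) (x p h : Fin n → ℝ) (u f : Fin m → ℝ)
    (hf : f = -(((pivot B R S)⁻¹ * Bᵀ) *ᵥ (S *ᵥ p + (1 / 2 : ℝ) • h))) :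
    quad M x + quad R u + (quad S (A *ᵥ x + B *ᵥ u + p) + h ⬝ᵥ (A *ᵥ x + B *ᵥ u + p)) =
      quad (riccatiStep A B M R S) x
        + ((A + B * gain A B R S)ᵀ *ᵥ ((2 : ℝ) • (S *ᵥ p) + h)) ⬝ᵥ x
        + quad (pivot B R S) (u - gain A B R S *ᵥ x - f)
        + (quad S p + h ⬝ᵥ p - quad (pivot B R S) f) := by
  have hSt := transpose_eq_of_posSemidef hS
  have hV := posDef_pivot (B := B) hR hS
  have hVt := transpose_eq_of_posSemidef hV.posSemidef
  have hdet : IsUnit (pivot B R S).det := (Matrix.isUnit_iff_isUnit_det _).1 hV.isUnit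
  -- The next two facts are the normal equations for `f` and for the gain. Except for the square of
  -- the gain term, the inverse enters only through them.
  have hpf : pivot B R S *ᵥ f = -(Bᵀ *ᵥ (S *ᵥ p + (1 / 2 : ℝ) • h)) := by
    rw [hf, Matrix.mulVec_neg, Matrix.mulVec_mulVec, ← Matrix.mul_assoc,
      Matrix.mul_nonsing_inv _ hdet, Matrix.one_mul]
  have hpK : pivot B R S * gain A B R S = -(Bᵀ * S * A) := by
    rw [gain, Matrix.mul_neg]
    simp only [← Matrix.mul_assoc]
    rw [Matrix.mul_nonsing_inv _ hdet, Matrix.one_mul]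
  have hKK : quad (pivot B R S) (gain A B R S *ᵥ x)
      = quad (Aᵀ * S * B * (pivot B R S)⁻¹ * Bᵀ * S * A) x := by
    rw [quad, Matrix.mulVec_mulVec, hpK, gain, quad, Matrix.neg_mulVec, Matrix.neg_mulVec,
      neg_dotProduct_neg, ← Matrix.vecMul_transpose, ← Matrix.dotProduct_mulVec,
      Matrix.mulVec_mulVec]
    simp only [Matrix.transpose_mul, Matrix.transpose_nonsing_inv, hVt, hSt,
      Matrix.transpose_transpose, Matrix.mul_assoc]
  have e1 : u - gain A B R S *ᵥ x - f = u + -(gain A B R S *ᵥ x + f) := by abel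
  have e2 : A *ᵥ x + B *ᵥ u + p = B *ᵥ u + (A *ᵥ x + p) := by abel
  have tr : ∀ (N : Matrix (Fin n) (Fin m) ℝ) (a : Fin n → ℝ) (b : Fin m → ℝ),
      (Nᵀ *ᵥ a) ⬝ᵥ b = a ⬝ᵥ N *ᵥ b := fun N a b => by
    rw [Matrix.mulVec_transpose, ← Matrix.dotProduct_mulVec]
  have hsw : (S *ᵥ p) ⬝ᵥ (A *ᵥ x) = (A *ᵥ x) ⬝ᵥ S *ᵥ p := dotProduct_comm _ _
  -- This cross term of the square is why the linear coefficient carries `(A + B K)ᵀ` instead of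
  -- `Aᵀ`.
  have hKf : (gain A B R S *ᵥ x) ⬝ᵥ pivot B R S *ᵥ f
      = -((S *ᵥ p) ⬝ᵥ (B *ᵥ gain A B R S *ᵥ x) + (1 / 2) * (h ⬝ᵥ B *ᵥ gain A B R S *ᵥ x)) := by
    rw [hpf, dotProduct_neg, dotProduct_comm, tr]
    simp [add_dotProduct]
  have huf : u ⬝ᵥ pivot B R S *ᵥ f = -((B *ᵥ u) ⬝ᵥ (S *ᵥ p) + (1 / 2) * (h ⬝ᵥ B *ᵥ u)) := by
    rw [hpf, dotProduct_neg, dotProduct_comm, tr, dotProduct_comm]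
    simp [dotProduct_add, dotProduct_comm]
  have huK : u ⬝ᵥ pivot B R S *ᵥ (gain A B R S *ᵥ x) = -((B *ᵥ u) ⬝ᵥ S *ᵥ (A *ᵥ x)) := by
    rw [Matrix.mulVec_mulVec, hpK, Matrix.neg_mulVec, dotProduct_neg, Matrix.mul_assoc,
      ← Matrix.mulVec_mulVec, dotProduct_comm, tr, dotProduct_comm, Matrix.mulVec_mulVec]
  have hlin : ((A + B * gain A B R S)ᵀ *ᵥ ((2 : ℝ) • (S *ᵥ p) + h)) ⬝ᵥ x
      = 2 * ((A *ᵥ x) ⬝ᵥ S *ᵥ p) + h ⬝ᵥ A *ᵥ x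
        + 2 * ((S *ᵥ p) ⬝ᵥ (B *ᵥ gain A B R S *ᵥ x)) + h ⬝ᵥ B *ᵥ gain A B R S *ᵥ x := by
    rw [Matrix.mulVec_transpose, ← Matrix.dotProduct_mulVec]
    simp only [Matrix.add_mulVec, ← Matrix.mulVec_mulVec, dotProduct_add, add_dotProduct,
      smul_dotProduct, smul_eq_mul, hsw]
    ring
  have hpu : quad (pivot B R S) u = quad R u + quad S (B *ᵥ u) := by
    rw [quad_mulVec, ← quad_add_left, pivot]
  rw [e1, e2, quad_add hVt, quad_neg, quad_add hVt, hKK, quad_add hSt, quad_add hSt, hlin, hpu,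
    riccatiStep, quad_add_left, quad_add_left, quad_neg_left, hKf, ← quad_mulVec S A]
  simp only [Matrix.mulVec_neg, Matrix.mulVec_add, dotProduct_add, dotProduct_neg, huf, huK]
  ring

/-- The form is the minimum over `u` of a nonnegative cost: at the minimizer `u = K x` the completed
square vanishes and only nonnegative terms remain on the other side. -/
theorem posSemidef_riccatiStep {A : Matrix (Fin n) (Fin n) ℝ} {B : Matrix (Fin n) (Fin m) ℝ}
    {M : Matrix (Fin n) (Fin n) ℝ} {R : Matrix (Fin m) (Fin m) ℝ} {S : Matrix (Fin n) (Fin n) ℝ}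
    (hM : M.PosSemidef) (hR : R.PosDef) (hS : S.PosSemidef) :
    (riccatiStep A B M R S).PosSemidef := by
  have hSt := transpose_eq_of_posSemidef hS
  have hMt := transpose_eq_of_posSemidef hM
  have hVt := transpose_eq_of_posSemidef (posDef_pivot (B := B) hR hS).posSemidef
  refine Matrix.PosSemidef.of_dotProduct_mulVec_nonneg ?_ fun x => ?_
  · rw [Matrix.IsHermitian, Matrix.conjTranspose_eq_transpose_of_trivial, riccatiStep]
    simp only [Matrix.transpose_add, Matrix.transpose_neg, Matrix.transpose_mul,
      Matrix.transpose_nonsing_inv, hVt, hSt, hMt, Matrix.transpose_transpose, Matrix.mul_assoc]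
  · have h := complete_square (A := A) (B := B) (M := M) hR hS x 0 0 (gain A B R S *ᵥ x) 0 (by simp)
    simp only [Matrix.mulVec_zero, smul_zero, add_zero, zero_dotProduct, sub_self] at h
    have z : quad (pivot B R S) 0 = 0 := by simp [quad]
    have z' : quad S 0 = 0 := by simp [quad]
    rw [z, z'] at h
    have h1 := quad_nonneg hM x
    have h2 := quad_nonneg hR.posSemidef (gain A B R S *ᵥ x)
    have h3 := quad_nonneg hS (A *ᵥ x + B *ᵥ (gain A B R S *ᵥ x))
    have : 0 ≤ quad (riccatiStep A B M R S) x := by linarith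
    simpa [quad] using this

theorem riccati_of_lt {T : ℕ} {A : ℕ → Matrix (Fin n) (Fin n) ℝ}
    {B : ℕ → Matrix (Fin n) (Fin m) ℝ} {M : ℕ → Matrix (Fin n) (Fin n) ℝ}
    {R : ℕ → Matrix (Fin m) (Fin m) ℝ} {t : ℕ} (ht : t < T) :
    riccati T A B M R t = riccatiStep (A t) (B t) (M t) (R t) (riccati T A B M R (t + 1)) := by
  rw [riccati, if_pos ht, riccatiStep]

theorem riccati_self {T : ℕ} {A : ℕ → Matrix (Fin n) (Fin n) ℝ}
    {B : ℕ → Matrix (Fin n) (Fin m) ℝ} {M : ℕ → Matrix (Fin n) (Fin n) ℝ}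
    {R : ℕ → Matrix (Fin m) (Fin m) ℝ} : riccati T A B M R T = M T := by
  rw [riccati, if_neg (lt_irrefl T)]

theorem posSemidef_riccati {T : ℕ} {A : ℕ → Matrix (Fin n) (Fin n) ℝ}
    {B : ℕ → Matrix (Fin n) (Fin m) ℝ} {M : ℕ → Matrix (Fin n) (Fin n) ℝ}
    {R : ℕ → Matrix (Fin m) (Fin m) ℝ} (hM : ∀ t ≤ T, (M t).PosSemidef)
    (hR : ∀ t < T, (R t).PosDef) {t : ℕ} (ht : t ≤ T) : (riccati T A B M R t).PosSemidef := by
  induction ht using Nat.decreasingInduction with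
  | self => rw [riccati_self]; exact hM T le_rfl
  | of_succ t ht ih => rw [riccati_of_lt ht]; exact posSemidef_riccatiStep (hM t ht.le) (hR t ht) ih

/-! ### Averages over the subsystems -/

theorem meanField_add (v v' : Fin k → Fin n → ℝ) :
    meanField (fun i => v i + v' i) = meanField v + meanField v' := by
  simp [meanField, Finset.sum_add_distrib]

theorem meanField_const [NeZero k] (v : Fin n → ℝ) : meanField (fun _ : Fin k => v) = v := by
  have : (k : ℝ) ≠ 0 := Nat.cast_ne_zero.2 (NeZero.ne k)
  rw [meanField, Finset.sum_const, Finset.card_univ, Fintype.card_fin, ← Nat.cast_smul_eq_nsmul ℝ,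
    smul_smul, inv_mul_cancel₀ this, one_smul]

theorem meanField_mulVec (A : Matrix (Fin m) (Fin n) ℝ) (v : Fin k → Fin n → ℝ) :
    meanField (fun i => A *ᵥ v i) = A *ᵥ meanField v := by
  rw [meanField, meanField, Matrix.mulVec_smul, Matrix.mulVec_sum]

theorem sum_eq_smul_meanField [NeZero k] (v : Fin k → Fin n → ℝ) :
    ∑ i, v i = (k : ℝ) • meanField v := by
  have : (k : ℝ) ≠ 0 := Nat.cast_ne_zero.2 (NeZero.ne k)
  rw [meanField, smul_smul, mul_inv_cancel₀ this, one_smul]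

/-- The deviations from the mean sum to zero, so no cross term survives. This decouples the costs of
the deviations from that of the mean-field. -/
theorem sum_quad_sub_meanField [NeZero k] {M : Matrix (Fin n) (Fin n) ℝ} (hM : Mᵀ = M)
    (v : Fin k → Fin n → ℝ) :
    ∑ i, quad M (v i - meanField v) = ∑ i, quad M (v i) - k * quad M (meanField v) := by
  have h : ∀ i, quad M (v i - meanField v)
      = quad M (v i) - 2 * (v i ⬝ᵥ M *ᵥ meanField v) + quad M (meanField v) := fun i => by
    rw [sub_eq_add_neg, quad_add hM, quad_neg, Matrix.mulVec_neg, dotProduct_neg]; ring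
  rw [Finset.sum_congr rfl fun i _ => h i, Finset.sum_add_distrib, Finset.sum_sub_distrib,
    ← Finset.mul_sum, ← sum_dotProduct, sum_eq_smul_meanField v, smul_dotProduct]
  simp only [Finset.sum_const, Finset.card_univ, Fintype.card_fin, nsmul_eq_mul, smul_eq_mul, quad]
  ring

end MeanFieldLQ

/-! ### Moments of a known vector plus an independent centred noise -/

namespace MeanFieldLQ

variable {k n m : ℕ} {Ω : Type*}

/-- Integrability of the product comes from independence, not from Hölder. Thus the fourth-degree
products of drift and noise below are integrable although the drift has only second moments. -/
theorem indep_mul {m₁ m₂ mΩ : MeasurableSpace Ω} {prob : Measure Ω}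
    (h : Indep m₁ m₂ prob) {X Z : Ω → ℝ} (hX : Measurable[m₁] X) (hZ : Measurable[m₂] Z)
    (hXi : Integrable X prob) (hZi : Integrable Z prob) :
    Integrable (fun ω => X ω * Z ω) prob ∧
      ∫ ω, X ω * Z ω ∂prob = (∫ ω, X ω ∂prob) * ∫ ω, Z ω ∂prob := by
  have hi : IndepFun X Z prob :=
    (IndepFun_iff_Indep _ _ _).2 (indep_of_indep_of_le_left
      (indep_of_indep_of_le_right h hZ.comap_le) hX.comap_le)
  exact ⟨hi.integrable_mul hXi hZi, hi.integral_mul_eq_mul_integral hXi.1 hZi.1⟩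

theorem measurable_quad {mΩ : MeasurableSpace Ω} (M : Matrix (Fin n) (Fin n) ℝ)
    {y : Ω → Fin n → ℝ} (hy : Measurable y) : Measurable fun ω => quad M (y ω) := by
  have h : ∀ a, Measurable fun ω => y ω a := fun a => (measurable_pi_apply a).comp hy
  simp only [quad_eq_sum]
  fun_prop

theorem measurable_mulVec {mΩ : MeasurableSpace Ω} (A : Matrix (Fin m) (Fin n) ℝ)
    {y : Ω → Fin n → ℝ} (hy : Measurable y) : Measurable fun ω => A *ᵥ y ω := by
  have h : ∀ a, Measurable fun ω => y ω a := fun a => (measurable_pi_apply a).comp hy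
  refine measurable_pi_lambda _ fun a => ?_
  simp only [Matrix.mulVec, dotProduct]
  fun_prop

theorem measurable_meanField {mΩ : MeasurableSpace Ω} {y : Ω → Fin k → Fin n → ℝ}
    (hy : Measurable y) : Measurable fun ω => meanField (y ω) := by
  have h : ∀ i, Measurable fun ω => y ω i := fun i => (measurable_pi_apply i).comp hy
  simp only [meanField]
  fun_prop

theorem measurable_comap_apply {d : Ω → Fin n → ℝ} (a : Fin n) :
    Measurable[MeasurableSpace.comap d inferInstance] fun ω => d ω a :=
  (measurable_pi_apply a).comp (comap_measurable d)

section L2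

variable {ℱ mΩ : MeasurableSpace Ω} {prob : Measure Ω}

/-- A random vector whose coordinates are square integrable. -/
def SqIntegrable {mΩ : MeasurableSpace Ω} (prob : Measure Ω) (y : Ω → Fin n → ℝ) : Prop :=
  ∀ a, MemLp (fun ω => y ω a) 2 prob

theorem SqIntegrable.add {y z : Ω → Fin n → ℝ} (hy : SqIntegrable prob y)
    (hz : SqIntegrable prob z) : SqIntegrable prob fun ω => y ω + z ω :=
  fun a => (hy a).add (hz a)

theorem SqIntegrable.sub {y z : Ω → Fin n → ℝ} (hy : SqIntegrable prob y)
    (hz : SqIntegrable prob z) : SqIntegrable prob fun ω => y ω - z ω :=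
  fun a => (hy a).sub (hz a)

theorem sqIntegrable_const [IsFiniteMeasure prob] (v : Fin n → ℝ) :
    SqIntegrable prob fun _ => v :=
  fun a => memLp_const (v a)

theorem SqIntegrable.mulVec {y : Ω → Fin n → ℝ} (hy : SqIntegrable prob y)
    (A : Matrix (Fin m) (Fin n) ℝ) : SqIntegrable prob fun ω => A *ᵥ y ω := fun a => by
  simp only [Matrix.mulVec, dotProduct]
  exact memLp_finsetSum _ fun b _ => (hy b).const_mul _

theorem SqIntegrable.meanField {y : Ω → Fin k → Fin n → ℝ}
    (hy : ∀ i, SqIntegrable prob fun ω => y ω i) :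
    SqIntegrable prob fun ω => meanField (y ω) := fun a => by
  simp only [MeanFieldLQ.meanField, Pi.smul_apply, Finset.sum_apply, smul_eq_mul]
  exact (memLp_finsetSum _ fun i _ => hy i a).const_mul _

theorem SqIntegrable.integrable_mul {y z : Ω → Fin n → ℝ} (hy : SqIntegrable prob y)
    (hz : SqIntegrable prob z) (a b : Fin n) : Integrable (fun ω => y ω a * z ω b) prob :=
  (hy a).integrable_mul (hz b)

theorem SqIntegrable.integrable_quad {y : Ω → Fin n → ℝ} (hy : SqIntegrable prob y)
    (M : Matrix (Fin n) (Fin n) ℝ) : Integrable (fun ω => quad M (y ω)) prob := by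
  simp only [quad_eq_sum]
  exact integrable_finsetSum _ fun a _ => integrable_finsetSum _ fun b _ =>
    (hy.integrable_mul hy a b).const_mul _

theorem SqIntegrable.integrable_dotProduct [IsFiniteMeasure prob] {y : Ω → Fin n → ℝ}
    (hy : SqIntegrable prob y) (v : Fin n → ℝ) : Integrable (fun ω => v ⬝ᵥ y ω) prob := by
  simp only [dotProduct]
  exact integrable_finsetSum _ fun a _ => ((hy a).integrable one_le_two).const_mul _

theorem sqIntegrable_of_integrable {y : Ω → Fin n → ℝ} (hm : Measurable y)
    (hy : Integrable (fun ω => y ω ⬝ᵥ y ω) prob) : SqIntegrable prob y := fun a => by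
  have hma : Measurable fun ω => y ω a := (measurable_pi_apply a).comp hm
  refine (memLp_two_iff_integrable_sq hma.aestronglyMeasurable).2
    (hy.mono (hma.pow_const 2).aestronglyMeasurable (.of_forall fun ω => ?_))
  have h0 : ∀ b, 0 ≤ y ω b * y ω b := fun b => mul_self_nonneg _
  have h1 : y ω a * y ω a ≤ y ω ⬝ᵥ y ω :=
    Finset.single_le_sum (f := fun b => y ω b * y ω b) (fun b _ => h0 b) (Finset.mem_univ a)
  rw [Real.norm_of_nonneg (sq_nonneg _), Real.norm_of_nonneg ((h0 a).trans h1), sq]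
  exact h1

theorem SqIntegrable.integrable_self {y : Ω → Fin n → ℝ} (hy : SqIntegrable prob y) :
    Integrable (fun ω => y ω ⬝ᵥ y ω) prob :=
  integrable_finsetSum _ fun a _ => hy.integrable_mul hy a a

/-- A centered random vector whose coordinates, and whose products of two coordinates, are square
integrable. -/
structure CenteredNoise {mΩ : MeasurableSpace Ω} (prob : Measure Ω) (d : Ω → Fin n → ℝ) : Prop where
  measurable : Measurable d
  sq : SqIntegrable prob d
  mul : ∀ a b, MemLp (fun ω => d ω a * d ω b) 2 prob
  integral : ∀ a, ∫ ω, d ω a ∂prob = 0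

theorem CenteredNoise.memLp_quad {d : Ω → Fin n → ℝ} (hd : CenteredNoise prob d)
    (M : Matrix (Fin n) (Fin n) ℝ) : MemLp (fun ω => quad M (d ω)) 2 prob := by
  simp only [quad_eq_sum]
  exact memLp_finsetSum _ fun a _ => memLp_finsetSum _ fun b _ => (hd.mul a b).const_mul _

variable [IsProbabilityMeasure prob]

theorem SqIntegrable.integral_dotProduct_add {y d : Ω → Fin n → ℝ} (hy : SqIntegrable prob y)
    (hd : SqIntegrable prob d) (hd0 : ∀ a, ∫ ω, d ω a ∂prob = 0) (v : Fin n → ℝ) :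
    ∫ ω, v ⬝ᵥ (y ω + d ω) ∂prob = ∫ ω, v ⬝ᵥ y ω ∂prob := by
  have h : ∫ ω, v ⬝ᵥ d ω ∂prob = 0 := by
    simp only [dotProduct]
    rw [integral_finsetSum _ fun a _ => ((hd a).integrable one_le_two).const_mul _]
    simp [integral_const_mul, hd0]
  simp only [dotProduct_add]
  rw [integral_add (hy.integrable_dotProduct v) (hd.integrable_dotProduct v), h, add_zero]

/-- The cross term has mean zero by independence. The noise thus contributes a constant that does
not involve `y`. -/
theorem integral_quad_add {y d : Ω → Fin n → ℝ}
    (hi : Indep ℱ (MeasurableSpace.comap d inferInstance) prob)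
    (hym : Measurable[ℱ] y) (hy : SqIntegrable prob y) (hd : SqIntegrable prob d)
    (hd0 : ∀ a, ∫ ω, d ω a ∂prob = 0) {M : Matrix (Fin n) (Fin n) ℝ} (hM : Mᵀ = M) :
    ∫ ω, quad M (y ω + d ω) ∂prob = ∫ ω, quad M (y ω) ∂prob + ∫ ω, quad M (d ω) ∂prob := by
  have hc : ∀ a b, Integrable (fun ω => M a b * (y ω a * d ω b)) prob := fun a b =>
    (hy.integrable_mul hd a b).const_mul _
  have hform : ∀ ω, 2 * (y ω ⬝ᵥ M *ᵥ d ω) = 2 * ∑ a, ∑ b, M a b * (y ω a * d ω b) := fun ω => by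
    simp only [dotProduct, Matrix.mulVec, Finset.mul_sum]
    exact Finset.sum_congr rfl fun a _ => Finset.sum_congr rfl fun b _ => by ring
  have hz : ∫ ω, 2 * ∑ a, ∑ b, M a b * (y ω a * d ω b) ∂prob = 0 := by
    rw [integral_const_mul, integral_finsetSum _ fun a _ => integrable_finsetSum _ fun b _ => hc a b]
    rw [Finset.sum_eq_zero, mul_zero]
    intro a _
    rw [integral_finsetSum _ fun b _ => hc a b]
    refine Finset.sum_eq_zero fun b _ => ?_
    rw [integral_const_mul, (indep_mul hi (X := fun ω => y ω a) ((measurable_pi_apply a).comp hym)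
      (measurable_comap_apply b) ((hy a).integrable one_le_two)
      ((hd b).integrable one_le_two)).2, hd0, mul_zero, mul_zero]
  have hci : Integrable (fun ω => 2 * ∑ a, ∑ b, M a b * (y ω a * d ω b)) prob :=
    (integrable_finsetSum _ fun a _ => integrable_finsetSum _ fun b _ => hc a b).const_mul _
  simp only [quad_add hM, hform]
  rw [integral_add ((hy.integrable_quad M).fun_add hci) (hd.integrable_quad M),
    integral_add (hy.integrable_quad M) hci, hz, add_zero]

/-- In the cross term, `Qy` is pulled out of the conditional expectation and leaves `E(d) = 0`; the
noise term is independent of `ℱ`, so its conditional expectation is its mean. -/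
theorem condExp_quad_add (hle : ℱ ≤ mΩ)
    {y d : Ω → Fin n → ℝ} (hd : CenteredNoise prob d)
    (hi : Indep ℱ (MeasurableSpace.comap d inferInstance) prob)
    (hym : Measurable[ℱ] y) (hy : SqIntegrable prob y)
    {Q : Matrix (Fin n) (Fin n) ℝ} (hQ : Qᵀ = Q) :
    prob[fun ω => quad Q (y ω + d ω) | ℱ] =ᵐ[prob]
      fun ω => quad Q (y ω) + ∫ ω', quad Q (d ω') ∂prob := by
  have hyQ := hy.mulVec Q
  have hymQ : ∀ a, Measurable[ℱ] fun ω => 2 * (Q *ᵥ y ω) a := fun a =>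
    ((measurable_pi_apply a).comp (measurable_mulVec Q hym)).const_mul 2
  have hle2 := hd.measurable.comap_le
  have hform : (fun ω => quad Q (y ω + d ω)) = (fun ω => quad Q (y ω))
      + (∑ a, (fun ω => 2 * (Q *ᵥ y ω) a) * (fun ω => d ω a)) + (fun ω => quad Q (d ω)) := by
    funext ω
    simp only [Pi.add_apply, Finset.sum_apply, Pi.mul_apply]
    rw [quad_add hQ, Matrix.dotProduct_mulVec, ← Matrix.mulVec_transpose, hQ, dotProduct,
      Finset.mul_sum]
    simp only [mul_assoc]
  have hint : ∀ a, Integrable ((fun ω => 2 * (Q *ᵥ y ω) a) * (fun ω => d ω a)) prob := fun a =>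
    ((hyQ a).const_mul 2).integrable_mul (hd.sq a)
  have hz : ∀ a, prob[(fun ω => 2 * (Q *ᵥ y ω) a) * (fun ω => d ω a) | ℱ] =ᵐ[prob] 0 := fun a => by
    have hdi := (hd.sq a).integrable one_le_two
    refine (condExp_mul_of_stronglyMeasurable_left (hymQ a).stronglyMeasurable
      (hint a) hdi).trans ?_
    have h := condExp_indep_eq hle2 hle
      (measurable_comap_apply (d := d) a).stronglyMeasurable hi.symm
    filter_upwards [h] with ω hω
    simp [hω, hd.integral]
  have hsum : prob[∑ a, (fun ω => 2 * (Q *ᵥ y ω) a) * (fun ω => d ω a) | ℱ] =ᵐ[prob] 0 := by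
    refine (condExp_finsetSum (fun a _ => hint a) ℱ).trans ?_
    filter_upwards [ae_all_iff.2 hz] with ω hω
    simp [Finset.sum_apply, hω]
  have hq : prob[fun ω => quad Q (y ω) | ℱ] = fun ω => quad Q (y ω) :=
    condExp_of_stronglyMeasurable hle (measurable_quad Q hym).stronglyMeasurable
      (hy.integrable_quad Q)
  have hqd := condExp_indep_eq hle2 hle
    (measurable_quad Q (comap_measurable d)).stronglyMeasurable hi.symm
  have hsi : Integrable (∑ a, (fun ω => 2 * (Q *ᵥ y ω) a) * (fun ω => d ω a)) prob :=
    integrable_finsetSum' _ fun a _ => hint a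
  rw [hform]
  have h1 := condExp_add ((hy.integrable_quad Q).add hsi) (hd.sq.integrable_quad Q) ℱ
  have h2 := condExp_add (hy.integrable_quad Q) hsi ℱ
  filter_upwards [h1, h2, hsum, hqd] with ω e1 e2 e3 e4
  rw [e1, Pi.add_apply, e2, Pi.add_apply, e3, e4, hq, Pi.zero_apply, add_zero]

/-- The prediction error of `quad Q (y + d)`, for `y` known and `d` an independent centered noise,
is square integrable, and its second moment is an affine quadratic functional of `y`. -/
theorem integral_sq_sub_condExp (hle : ℱ ≤ mΩ)
    {y d : Ω → Fin n → ℝ} (hd : CenteredNoise prob d)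
    (hi : Indep ℱ (MeasurableSpace.comap d inferInstance) prob)
    (hym : Measurable[ℱ] y) (hy : SqIntegrable prob y)
    {Q : Matrix (Fin n) (Fin n) ℝ} (hQ : Qᵀ = Q) :
    Integrable (fun ω => (quad Q (y ω + d ω) - (prob[fun ω => quad Q (y ω + d ω) | ℱ]) ω) ^ 2)
        prob ∧
      ∫ ω, (quad Q (y ω + d ω) - (prob[fun ω => quad Q (y ω + d ω) | ℱ]) ω) ^ 2 ∂prob =
        4 * ∫ ω, quad (Q * Matrix.of (fun a b => ∫ ω, d ω a * d ω b ∂prob) * Q) (y ω) ∂prob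
        + 4 * ∫ ω, (Q *ᵥ fun a => ∫ ω, d ω a * quad Q (d ω) ∂prob) ⬝ᵥ y ω ∂prob
        + ∫ ω, (quad Q (d ω) - ∫ ω', quad Q (d ω') ∂prob) ^ 2 ∂prob := by
  set c := ∫ ω', quad Q (d ω') ∂prob with hc
  have hyQ := hy.mulVec Q
  have hymQ : ∀ a, Measurable[ℱ] fun ω => (Q *ᵥ y ω) a := fun a =>
    (measurable_pi_apply a).comp (measurable_mulVec Q hym)
  have hmd := fun a => measurable_comap_apply (d := d) a
  have hh : MemLp (fun ω => quad Q (d ω) - c) 2 prob := (hd.memLp_quad Q).sub (memLp_const c)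
  have hhm : Measurable[MeasurableSpace.comap d inferInstance] fun ω => quad Q (d ω) - c :=
    (measurable_quad Q (comap_measurable d)).sub_const c
  -- The error is `2 (Qy)·d + (dᵀQd - c)`. Its square is written as sums of products of an
  -- `ℱ`-measurable factor and a noise factor, so that each expectation factorizes.
  have hae : (fun ω => (quad Q (y ω + d ω) - (prob[fun ω => quad Q (y ω + d ω) | ℱ]) ω) ^ 2)
      =ᵐ[prob] fun ω =>
        4 * ∑ a, ∑ b, ((Q *ᵥ y ω) a * (Q *ᵥ y ω) b) * (d ω a * d ω b)
        + 4 * ∑ a, (Q *ᵥ y ω) a * (d ω a * (quad Q (d ω) - c))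
        + (quad Q (d ω) - c) ^ 2 := by
    filter_upwards [condExp_quad_add hle hd hi hym hy hQ] with ω hω
    have e1 : y ω ⬝ᵥ Q *ᵥ d ω = ∑ a, (Q *ᵥ y ω) a * d ω a := by
      rw [Matrix.dotProduct_mulVec, ← Matrix.mulVec_transpose, hQ, dotProduct]
    have e2 : ∑ a, ∑ b, ((Q *ᵥ y ω) a * (Q *ᵥ y ω) b) * (d ω a * d ω b)
        = (∑ a, (Q *ᵥ y ω) a * d ω a) * ∑ a, (Q *ᵥ y ω) a * d ω a := by
      rw [Finset.sum_mul_sum]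
      exact Finset.sum_congr rfl fun a _ => Finset.sum_congr rfl fun b _ => by ring
    have e3 : ∑ a, (Q *ᵥ y ω) a * (d ω a * (quad Q (d ω) - c))
        = (∑ a, (Q *ᵥ y ω) a * d ω a) * (quad Q (d ω) - c) := by
      rw [Finset.sum_mul]
      exact Finset.sum_congr rfl fun a _ => by ring
    rw [hω, quad_add hQ, e1, e2, e3]
    ring
  have i1 : ∀ a b, _ := fun a b => indep_mul hi ((hymQ a).fun_mul (hymQ b)) ((hmd a).fun_mul (hmd b))
    (hyQ.integrable_mul hyQ a b) (hd.sq.integrable_mul hd.sq a b)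
  have i2 : ∀ a, _ := fun a => indep_mul hi (hymQ a) ((hmd a).fun_mul hhm)
    ((hyQ a).integrable one_le_two) ((hd.sq a).integrable_mul hh)
  have j1 : Integrable (fun ω => 4 * ∑ a, ∑ b,
      ((Q *ᵥ y ω) a * (Q *ᵥ y ω) b) * (d ω a * d ω b)) prob :=
    (integrable_finsetSum _ fun a _ => integrable_finsetSum _ fun b _ => (i1 a b).1).const_mul 4
  have j2 : Integrable (fun ω => 4 * ∑ a, (Q *ᵥ y ω) a * (d ω a * (quad Q (d ω) - c))) prob :=
    (integrable_finsetSum _ fun a _ => (i2 a).1).const_mul 4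
  have j3 : Integrable (fun ω => (quad Q (d ω) - c) ^ 2) prob := hh.integrable_sq
  refine ⟨((j1.add j2).add j3).congr hae.symm, ?_⟩
  rw [integral_congr_ae hae, integral_add (j1.fun_add j2) j3, integral_add j1 j2, integral_const_mul,
    integral_const_mul, integral_finsetSum _ fun a _ => integrable_finsetSum _ fun b _ => (i1 a b).1,
    integral_finsetSum _ fun a _ => (i2 a).1]
  congr 3
  · have e : ∀ ω, quad (Q * Matrix.of (fun a b => ∫ ω, d ω a * d ω b ∂prob) * Q) (y ω)
        = ∑ a, ∑ b, (∫ ω, d ω a * d ω b ∂prob) * ((Q *ᵥ y ω) a * (Q *ᵥ y ω) b) := fun ω => by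
      -- Reading `QΣQ` as `QᵀΣQ` turns the form into that of `Σ` at `Qy`.
      nth_rewrite 1 [← hQ]
      rw [← quad_mulVec, quad_eq_sum]
      rfl
    simp only [e]
    rw [integral_finsetSum _ fun a _ => integrable_finsetSum _ fun b _ =>
      (hyQ.integrable_mul hyQ a b).const_mul _]
    refine Finset.sum_congr rfl fun a _ => ?_
    rw [integral_finsetSum _ fun b _ => (i1 a b).1,
      integral_finsetSum _ fun b _ => (hyQ.integrable_mul hyQ a b).const_mul _]
    refine Finset.sum_congr rfl fun b _ => ?_
    rw [(i1 a b).2, integral_const_mul, mul_comm]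
  · have e : ∀ ω, (Q *ᵥ fun a => ∫ ω, d ω a * quad Q (d ω) ∂prob) ⬝ᵥ y ω
        = ∑ a, (∫ ω, d ω a * quad Q (d ω) ∂prob) * (Q *ᵥ y ω) a := fun ω => by
      rw [dotProduct_comm, Matrix.dotProduct_mulVec, ← Matrix.mulVec_transpose, hQ,
        dotProduct_comm, dotProduct]
    simp only [e]
    rw [integral_finsetSum _ fun a _ => ((hyQ a).integrable one_le_two).const_mul _]
    refine Finset.sum_congr rfl fun a _ => ?_
    rw [(i2 a).2, integral_const_mul, mul_comm]
    congr 1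
    -- Subtracting `c` does not change the skew vector, since `E(d) = 0`.
    simp only [mul_sub]
    have hdq : Integrable (fun ω => d ω a * quad Q (d ω)) prob :=
      (hd.sq a).integrable_mul (hd.memLp_quad Q)
    rw [integral_sub hdq
      (((hd.sq a).integrable one_le_two).mul_const c), integral_mul_const, hd.integral, zero_mul,
      sub_zero]

end L2

end MeanFieldLQ

/-! ### The risk-adjusted problem and its dynamic programming identity -/

namespace MeanFieldLQ

variable {k n m : ℕ} {Ω : Type*} [mΩ : MeasurableSpace Ω]

theorem transpose_noiseCov (prob : Measure Ω) (ξ : Ω → Fin n → ℝ) :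
    (noiseCov prob ξ)ᵀ = noiseCov prob ξ := by
  ext a b
  simp only [Matrix.transpose_apply, noiseCov, Matrix.of_apply, mul_comm]

/-- `vᵀΣv` is the variance of `v·ξ`; this gives the positivity of `Σ`, and with it that of `Q^λ`. -/
theorem quad_noiseCov {prob : Measure Ω} {ξ : Ω → Fin n → ℝ}
    (hξ : SqIntegrable prob fun ω => ξ ω - noiseMean prob ξ) (v : Fin n → ℝ) :
    quad (noiseCov prob ξ) v = ∫ ω, (v ⬝ᵥ (ξ ω - noiseMean prob ξ)) ^ 2 ∂prob := by
  have e : ∀ ω, (v ⬝ᵥ (ξ ω - noiseMean prob ξ)) ^ 2 = ∑ a, ∑ b, (v a * v b) *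
      ((ξ ω - noiseMean prob ξ) a * (ξ ω - noiseMean prob ξ) b) := fun ω => by
    rw [sq, dotProduct, Finset.sum_mul_sum]
    exact Finset.sum_congr rfl fun a _ => Finset.sum_congr rfl fun b _ => by ring
  have i := fun a b => (hξ.integrable_mul hξ a b).const_mul (v a * v b)
  simp only [e]
  rw [integral_finsetSum _ fun a _ => integrable_finsetSum _ fun b _ => i a b, quad_eq_sum]
  refine Finset.sum_congr rfl fun a _ => ?_
  rw [integral_finsetSum _ fun b _ => i a b]
  refine Finset.sum_congr rfl fun b _ => ?_
  rw [integral_const_mul, noiseCov, Matrix.of_apply, mul_comm]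

theorem posSemidef_Qlam {prob : Measure Ω} {D : Data k n m} {ξ : Ω → Fin n → ℝ}
    (hξ : SqIntegrable prob fun ω => ξ ω - noiseMean prob ξ) (hlam : 0 ≤ D.lam) {t : ℕ}
    (hQ : (D.Q t).PosSemidef) : (Qlam prob D ξ t).PosSemidef := by
  have hQt := transpose_eq_of_posSemidef hQ
  have hcov : (noiseCov prob ξ).PosSemidef := by
    refine Matrix.PosSemidef.of_dotProduct_mulVec_nonneg ?_ fun v => ?_
    · rw [Matrix.IsHermitian, Matrix.conjTranspose_eq_transpose_of_trivial, transpose_noiseCov]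
    · have : 0 ≤ quad (noiseCov prob ξ) v := by
        rw [quad_noiseCov hξ]
        exact integral_nonneg fun ω => sq_nonneg _
      simpa [quad] using this
  have h := hcov.conjTranspose_mul_mul_same (D.Q t)
  rw [Matrix.conjTranspose_eq_transpose_of_trivial, hQt] at h
  exact h.smul (by positivity)

/-- Positivity of the cost matrices and of the variance terms of the risk-adjusted problem. -/
structure RiskAdjusted (prob : Measure Ω) (D : Data k n m) (ξ : Ω → Fin n → ℝ) : Prop where
  posP : ∀ t ≤ D.T, (D.P t).PosSemidef
  posQ : ∀ t ≤ D.T, (D.Q t).PosSemidef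
  posR : ∀ t < D.T, (D.R t).PosDef
  posQlam : ∀ t ≤ D.T, (Qlam prob D ξ t).PosSemidef

variable {prob : Measure Ω} {D : Data k n m} {ξ : Ω → Fin n → ℝ}

theorem RiskAdjusted.posSemidef_S (h : RiskAdjusted prob D ξ) {t : ℕ} (ht : t ≤ D.T) :
    (S prob D ξ t).PosSemidef :=
  posSemidef_riccati (fun s hs => (h.posQ s hs).add (h.posQlam s hs)) h.posR ht

theorem RiskAdjusted.posSemidef_Sbar (h : RiskAdjusted prob D ξ) {t : ℕ} (ht : t ≤ D.T) :
    (Sbar prob D ξ t).PosSemidef :=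
  posSemidef_riccati (fun s hs => ((h.posP s hs).add (h.posQ s hs)).add (h.posQlam s hs)) h.posR ht

theorem RiskAdjusted.posDef_pivot_S (h : RiskAdjusted prob D ξ) {t : ℕ} (ht : t < D.T) :
    (pivot (D.B t) (D.R t) (S prob D ξ (t + 1))).PosDef :=
  posDef_pivot (h.posR t ht) (h.posSemidef_S ht)

theorem RiskAdjusted.posDef_pivot_Sbar (h : RiskAdjusted prob D ξ) {t : ℕ} (ht : t < D.T) :
    (pivot (D.B t) (D.R t) (Sbar prob D ξ (t + 1))).PosDef :=
  posDef_pivot (h.posR t ht) (h.posSemidef_Sbar ht)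

/-- The optimal control of a subsystem in state `xi` when the mean-field is `xbar`. -/
noncomputable def feedback (prob : Measure Ω) (D : Data k n m) (ξ : Ω → Fin n → ℝ) (t : ℕ)
    (xi xbar : Fin n → ℝ) : Fin m → ℝ :=
  K prob D ξ t *ᵥ xi + (Kbar prob D ξ t - K prob D ξ t) *ᵥ xbar + f prob D ξ t

/-- The excess cost at time `t` of the controls `u` in the states `x`. -/
noncomputable def gap (prob : Measure Ω) (D : Data k n m) (ξ : Ω → Fin n → ℝ) (t : ℕ)
    (x : Fin k → Fin n → ℝ) (u : Fin k → Fin m → ℝ) : ℝ :=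
  ∑ i, quad (pivot (D.B t) (D.R t) (S prob D ξ (t + 1)))
      (u i - meanField u - K prob D ξ t *ᵥ (x i - meanField x))
    + k * quad (pivot (D.B t) (D.R t) (Sbar prob D ξ (t + 1)))
      (meanField u - Kbar prob D ξ t *ᵥ meanField x - f prob D ξ t)

theorem RiskAdjusted.gap_nonneg (h : RiskAdjusted prob D ξ) {t : ℕ} (ht : t < D.T)
    (x : Fin k → Fin n → ℝ) (u : Fin k → Fin m → ℝ) : 0 ≤ gap prob D ξ t x u :=
  add_nonneg (Finset.sum_nonneg fun _ _ => quad_nonneg (h.posDef_pivot_S ht).posSemidef _)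
    (mul_nonneg k.cast_nonneg (quad_nonneg (h.posDef_pivot_Sbar ht).posSemidef _))

theorem RiskAdjusted.eq_feedback_of_gap_eq_zero [NeZero k] (h : RiskAdjusted prob D ξ) {t : ℕ}
    (ht : t < D.T) {x : Fin k → Fin n → ℝ} {u : Fin k → Fin m → ℝ}
    (h0 : gap prob D ξ t x u = 0) (i : Fin k) :
    u i = feedback prob D ξ t (x i) (meanField x) := by
  have hk : (0 : ℝ) < k := Nat.cast_pos.2 (NeZero.pos k)
  have n1 : ∀ i ∈ Finset.univ, 0 ≤ quad (pivot (D.B t) (D.R t) (S prob D ξ (t + 1)))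
      (u i - meanField u - K prob D ξ t *ᵥ (x i - meanField x)) :=
    fun _ _ => quad_nonneg (h.posDef_pivot_S ht).posSemidef _
  obtain ⟨h1, h2⟩ := (add_eq_zero_iff_of_nonneg (Finset.sum_nonneg n1)
    (mul_nonneg hk.le (quad_nonneg (h.posDef_pivot_Sbar ht).posSemidef _))).1 h0
  have e1 := eq_zero_of_quad_eq_zero (h.posDef_pivot_S ht)
    ((Finset.sum_eq_zero_iff_of_nonneg n1).1 h1 i (Finset.mem_univ i))
  have e2 := eq_zero_of_quad_eq_zero (h.posDef_pivot_Sbar ht)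
    ((mul_eq_zero.1 h2).resolve_left hk.ne')
  -- The two vectors inside the squares of `gap` add up to the distance of `u i` from the feedback
  -- law.
  have e : u i - feedback prob D ξ t (x i) (meanField x)
      = (u i - meanField u - K prob D ξ t *ᵥ (x i - meanField x))
        + (meanField u - Kbar prob D ξ t *ᵥ meanField x - f prob D ξ t) := by
    rw [feedback, Matrix.sub_mulVec, Matrix.mulVec_sub]; abel
  rw [e1, e2, add_zero] at e
  exact sub_eq_zero.1 e

/-- Averaging the feedback law cancels the `K` terms and leaves `ū = K̄ x̄ + f`, so both squares
vanish. -/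
theorem gap_feedback [NeZero k] {t : ℕ} {x : Fin k → Fin n → ℝ} {u : Fin k → Fin m → ℝ}
    (hu : ∀ i, u i = feedback prob D ξ t (x i) (meanField x)) : gap prob D ξ t x u = 0 := by
  have hbar : meanField u = Kbar prob D ξ t *ᵥ meanField x + f prob D ξ t := by
    rw [funext hu]
    simp only [feedback]
    rw [meanField_add, meanField_add, meanField_mulVec, meanField_const, meanField_const,
      Matrix.sub_mulVec]
    abel
  have e : ∀ i, u i - meanField u - K prob D ξ t *ᵥ (x i - meanField x) = 0 := fun i => by
    rw [hbar, hu, feedback, Matrix.sub_mulVec, Matrix.mulVec_sub]; abel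
  have e' : meanField u - Kbar prob D ξ t *ᵥ meanField x - f prob D ξ t = 0 := by
    rw [hbar]; abel
  simp [gap, e, e', quad]

/-- The optimal cost-to-go at time `t`, up to a constant. -/
noncomputable def value (prob : Measure Ω) (D : Data k n m) (ξ : Ω → Fin n → ℝ) (t : ℕ)
    (x : Fin k → Fin n → ℝ) : ℝ :=
  ∑ i, quad (S prob D ξ t) (x i)
    + k * (quad (Sbar prob D ξ t - S prob D ξ t) (meanField x) + g prob D ξ t ⬝ᵥ meanField x)

/-- The state cost together with the part of the expected risk cost that depends on the state. -/
noncomputable def adjustedCost (prob : Measure Ω) (D : Data k n m) (ξ : Ω → Fin n → ℝ) (t : ℕ)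
    (x : Fin k → Fin n → ℝ) : ℝ :=
  stateCost D t x + ∑ i, (quad (Qlam prob D ξ t) (x i) + blam prob D ξ t ⬝ᵥ x i)

theorem adjustedCost_eq [NeZero k] (t : ℕ) (x : Fin k → Fin n → ℝ) :
    adjustedCost prob D ξ t x = ∑ i, quad (D.Q t + Qlam prob D ξ t) (x i)
      + k * (quad (D.P t) (meanField x) + blam prob D ξ t ⬝ᵥ meanField x) := by
  have hb : ∑ i, blam prob D ξ t ⬝ᵥ x i = k * (blam prob D ξ t ⬝ᵥ meanField x) := by
    rw [← dotProduct_sum, sum_eq_smul_meanField, dotProduct_smul, smul_eq_mul]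
  simp only [adjustedCost, stateCost, quad_add_left, Finset.sum_add_distrib, hb, Finset.sum_const,
    Finset.card_univ, Fintype.card_fin, nsmul_eq_mul]
  ring

theorem value_terminal [NeZero k] (x : Fin k → Fin n → ℝ) :
    value prob D ξ D.T x = adjustedCost prob D ξ D.T x := by
  have hg : g prob D ξ D.T = blam prob D ξ D.T := by rw [g, if_neg (lt_irrefl _)]
  rw [value, adjustedCost_eq, hg, S, Sbar, riccati_self, riccati_self, quad_sub_left]
  simp only [quad_add_left]
  ring

/-- The state at time `t + 1` without disturbance, shifted by `μ`. -/
noncomputable def drift (D : Data k n m) (μ : Fin n → ℝ) (t : ℕ) (x : Fin k → Fin n → ℝ)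
    (u : Fin k → Fin m → ℝ) (i : Fin k) : Fin n → ℝ :=
  D.A t *ᵥ x i + D.B t *ᵥ u i + D.C t *ᵥ meanField x + μ

theorem meanField_drift [NeZero k] (μ : Fin n → ℝ) (t : ℕ) (x : Fin k → Fin n → ℝ)
    (u : Fin k → Fin m → ℝ) :
    meanField (drift D μ t x u)
      = (D.A t + D.C t) *ᵥ meanField x + D.B t *ᵥ meanField u + μ := by
  have e : drift D μ t x u
      = fun i => D.A t *ᵥ x i + D.B t *ᵥ u i + D.C t *ᵥ meanField x + μ := rfl
  rw [e, meanField_add, meanField_add, meanField_add, meanField_mulVec, meanField_mulVec,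
    meanField_const, meanField_const, Matrix.add_mulVec]
  abel

/-- `value` equals `∑ (xⁱ - x̄)ᵀ S (xⁱ - x̄) + k (x̄ᵀ S̄ x̄ + g·x̄)`, so the identity is the sum of
one completed square per deviation and `k` copies of the one for the mean-field. -/
theorem RiskAdjusted.dynamic_programming [NeZero k] (h : RiskAdjusted prob D ξ) {t : ℕ}
    (ht : t < D.T) : ∃ c : ℝ, ∀ (x : Fin k → Fin n → ℝ) (u : Fin k → Fin m → ℝ),
      adjustedCost prob D ξ t x + controlCost D t u
          + value prob D ξ (t + 1) (drift D (noiseMean prob ξ) t x u)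
        = value prob D ξ t x + gap prob D ξ t x u + c := by
  -- The constant left by the mean-field square; the deviations have no affine part and leave none.
  refine ⟨k * (quad (Sbar prob D ξ (t + 1)) (noiseMean prob ξ)
    + g prob D ξ (t + 1) ⬝ᵥ noiseMean prob ξ
    - quad (pivot (D.B t) (D.R t) (Sbar prob D ξ (t + 1))) (f prob D ξ t)), fun x u => ?_⟩
  have hS := h.posSemidef_S (Nat.succ_le_of_lt ht)
  have hSb := h.posSemidef_Sbar (Nat.succ_le_of_lt ht)
  have hM := (h.posQ t ht.le).add (h.posQlam t ht.le)
  have eS : S prob D ξ t = riccatiStep (D.A t) (D.B t) (D.Q t + Qlam prob D ξ t) (D.R t)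
      (S prob D ξ (t + 1)) := riccati_of_lt ht
  have eSb : Sbar prob D ξ t = riccatiStep (D.A t + D.C t) (D.B t)
      (D.P t + D.Q t + Qlam prob D ξ t) (D.R t) (Sbar prob D ξ (t + 1)) := riccati_of_lt ht
  have eg : g prob D ξ t = (D.A t + D.C t + D.B t * Kbar prob D ξ t)ᵀ *ᵥ
        ((2 : ℝ) • (Sbar prob D ξ (t + 1) *ᵥ noiseMean prob ξ) + g prob D ξ (t + 1))
      + blam prob D ξ t := by rw [g, if_pos ht]
  have hbar := complete_square (A := D.A t + D.C t) (B := D.B t)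
    (M := D.P t + D.Q t + Qlam prob D ξ t) (h.posR t ht) hSb (meanField x) (noiseMean prob ξ)
    (g prob D ξ (t + 1)) (meanField u) (f prob D ξ t) rfl
  rw [← eSb, ← meanField_drift] at hbar
  have hdev : ∀ i, quad (D.Q t + Qlam prob D ξ t) (x i - meanField x)
      + quad (D.R t) (u i - meanField u)
      + quad (S prob D ξ (t + 1)) (drift D (noiseMean prob ξ) t x u i
          - meanField (drift D (noiseMean prob ξ) t x u))
      = quad (S prob D ξ t) (x i - meanField x)
        + quad (pivot (D.B t) (D.R t) (S prob D ξ (t + 1)))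
          (u i - meanField u - K prob D ξ t *ᵥ (x i - meanField x)) := fun i => by
    have hi := complete_square (A := D.A t) (B := D.B t) (M := D.Q t + Qlam prob D ξ t)
      (h.posR t ht) hS (x i - meanField x) 0 0 (u i - meanField u) 0 (by simp)
    have z : ∀ (j : ℕ) (N : Matrix (Fin j) (Fin j) ℝ), quad N 0 = 0 := fun j N => by simp [quad]
    have ed : drift D (noiseMean prob ξ) t x u i - meanField (drift D (noiseMean prob ξ) t x u)
        = D.A t *ᵥ (x i - meanField x) + D.B t *ᵥ (u i - meanField u) := by
      rw [meanField_drift, drift, Matrix.add_mulVec, Matrix.mulVec_sub, Matrix.mulVec_sub]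
      abel
    simp only [Matrix.mulVec_zero, smul_zero, add_zero, zero_dotProduct, sub_zero, z, ← eS] at hi
    rw [ed]
    exact hi
  have hsum := Finset.sum_congr (rfl : (Finset.univ : Finset (Fin k)) = _) fun i _ => hdev i
  simp only [Finset.sum_add_distrib] at hsum
  rw [sum_quad_sub_meanField (transpose_eq_of_posSemidef hM),
    sum_quad_sub_meanField (transpose_eq_of_posSemidef (h.posR t ht).posSemidef),
    sum_quad_sub_meanField (transpose_eq_of_posSemidef hS),
    sum_quad_sub_meanField (transpose_eq_of_posSemidef (h.posSemidef_S ht.le))] at hsum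
  have eP : quad (D.P t + D.Q t + Qlam prob D ξ t) (meanField x)
      = quad (D.P t) (meanField x) + quad (D.Q t + Qlam prob D ξ t) (meanField x) := by
    rw [add_assoc, quad_add_left]
  rw [eP] at hbar
  rw [adjustedCost_eq, value, value, gap, controlCost, quad_sub_left, quad_sub_left, eg,
    add_dotProduct]
  simp only [Kbar]
  linear_combination hsum + (k : ℝ) * hbar

end MeanFieldLQ

/-! ### Histories, noise filtration and the expected risk cost -/

namespace MeanFieldLQ

variable {k n m : ℕ} {Ω : Type*} {D : Data k n m} {w : ℕ → Ω → Fin k → Fin n → ℝ}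
  {u : ℕ → Ω → Fin k → Fin m → ℝ}

theorem measurable_of_apply {ι : Type*} {β : ι → Type*} [∀ i, MeasurableSpace (β i)]
    {ℱ : MeasurableSpace Ω} {y : Ω → ∀ i, β i} (hy : ∀ i, Measurable fun ω => y ω i) :
    Measurable y :=
  measurable_pi_iff.2 hy

theorem measurable_state_histSigma {s t : ℕ} (h : s ≤ t) :
    Measurable[histSigma D w u t] (state D w u s) :=
  (measurable_pi_apply (⟨s, Nat.lt_succ_of_le h⟩ : Fin (t + 1))).comp
    (measurable_fst.comp (comap_measurable (history D w u t)))

theorem histSigma_le_of_measurable {ℱ : MeasurableSpace Ω} {t : ℕ}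
    (hx : ∀ s ≤ t, Measurable[ℱ] (state D w u s)) (hu : ∀ s < t, Measurable[ℱ] (u s)) :
    histSigma D w u t ≤ ℱ :=
  Measurable.comap_le (Measurable.prodMk
    (measurable_pi_lambda _ fun s => hx s (Nat.le_of_lt_succ s.2))
    (measurable_pi_lambda _ fun s => hu s s.2))

theorem state_succ (t : ℕ) (μ : Fin n → ℝ) (ω : Ω) (i : Fin k) :
    state D w u (t + 1) ω i
      = drift D μ t (state D w u t ω) (u t ω) i + (w (t + 1) ω i - μ) := by
  rw [drift, add_add_sub_cancel]
  rfl

theorem measurable_drift {ℱ : MeasurableSpace Ω} {x : Ω → Fin k → Fin n → ℝ}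
    {v : Ω → Fin k → Fin m → ℝ} (hx : Measurable x) (hv : Measurable v) (μ : Fin n → ℝ) (t : ℕ)
    (i : Fin k) : Measurable fun ω => drift D μ t (x ω) (v ω) i :=
  (((measurable_mulVec _ ((measurable_pi_apply i).comp hx)).add
    (measurable_mulVec _ ((measurable_pi_apply i).comp hv))).add
    (measurable_mulVec _ (measurable_meanField hx))).add_const μ

/-- The σ-algebra generated by `w₁, …, w_t`. -/
@[reducible] def noiseSigma (T : ℕ) (w : ℕ → Ω → Fin k → Fin n → ℝ) (t : ℕ) : MeasurableSpace Ω :=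
  ⨆ s ∈ {s : Fin T | (s : ℕ) < t}, MeasurableSpace.comap (w (s + 1)) inferInstance

theorem noiseSigma_mono (T : ℕ) (w : ℕ → Ω → Fin k → Fin n → ℝ) : Monotone (noiseSigma T w) :=
  fun _ _ h => biSup_mono fun _ hs => lt_of_lt_of_le hs h

theorem measurable_noiseSigma {T t : ℕ} (ht : t < T) : Measurable[noiseSigma T w (t + 1)] (w (t + 1)) :=
  (comap_measurable (w (t + 1))).mono (le_biSup (f := fun s : Fin T =>
    MeasurableSpace.comap (w (s + 1)) inferInstance) (i := ⟨t, ht⟩) (Nat.lt_succ_self t)) le_rfl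

theorem SqIntegrable.drift {mΩ : MeasurableSpace Ω} {prob : Measure Ω} [IsProbabilityMeasure prob]
    {x : Ω → Fin k → Fin n → ℝ} {v : Ω → Fin k → Fin m → ℝ} (hx : ∀ i, SqIntegrable prob fun ω => x ω i)
    (hv : ∀ i, SqIntegrable prob fun ω => v ω i) (μ : Fin n → ℝ) (t : ℕ) (i : Fin k) :
    SqIntegrable prob fun ω => drift D μ t (x ω) (v ω) i :=
  ((((hx i).mulVec _).add ((hv i).mulVec _)).add ((SqIntegrable.meanField hx).mulVec _)).add
    (sqIntegrable_const μ)

variable [mΩ : MeasurableSpace Ω] {prob : Measure Ω}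

section Noise

theorem SqIntegrable.memLp_mul_of_memLp_self {y : Ω → Fin n → ℝ} (hm : Measurable y)
    (hy : MemLp (fun ω => y ω ⬝ᵥ y ω) 2 prob) (a b : Fin n) :
    MemLp (fun ω => y ω a * y ω b) 2 prob := by
  have hma : ∀ a, Measurable fun ω => y ω a := fun a => (measurable_pi_apply a).comp hm
  refine hy.mono' ((hma a).mul (hma b)).aestronglyMeasurable (.of_forall fun ω => ?_)
  have h1 : ∀ a, y ω a * y ω a ≤ y ω ⬝ᵥ y ω := fun a =>
    Finset.single_le_sum (f := fun b => y ω b * y ω b) (fun b _ => mul_self_nonneg _)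
      (Finset.mem_univ a)
  rw [Real.norm_eq_abs, abs_le]
  -- `|y_a y_b| ≤ (y_a² + y_b²) / 2 ≤ y·y`.
  constructor <;> nlinarith [h1 a, h1 b, sq_nonneg (y ω a + y ω b), sq_nonneg (y ω a - y ω b)]

variable [NeZero k] {T : ℕ}

/-- Every disturbance has the law of the reference `w 1 · 0`, so `μ`, `Σ` and `γ` computed from it
serve all subsystems and times. -/
theorem DisturbanceAssumption.identDistrib (hw : DisturbanceAssumption prob T w) {t : ℕ}
    (ht : t < T) (i : Fin k) :
    IdentDistrib (fun ω => w (t + 1) ω i) (fun ω => w 1 ω 0) prob prob :=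
  (hw.ident_sub t ht i 0).trans
    ((hw.ident_time t ht 0 (Nat.zero_lt_of_lt ht)).comp (measurable_pi_apply (0 : Fin k)))

theorem DisturbanceAssumption.noiseCov_eq (hw : DisturbanceAssumption prob T w) {t : ℕ}
    (ht : t < T) (i : Fin k) (μ : Fin n → ℝ) (hμ : μ = noiseMean prob fun ω => w 1 ω 0) :
    Matrix.of (fun a b => ∫ ω, (w (t + 1) ω i - μ) a * (w (t + 1) ω i - μ) b ∂prob)
      = noiseCov prob fun ω => w 1 ω 0 := by
  ext a b
  rw [noiseCov, Matrix.of_apply, Matrix.of_apply, ← hμ]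
  have hm : Measurable fun v : Fin n → ℝ => (v - μ) a * (v - μ) b := by
    simp only [Pi.sub_apply]
    fun_prop
  exact ((hw.identDistrib ht i).comp hm).integral_eq

theorem DisturbanceAssumption.noiseSkew_eq (hw : DisturbanceAssumption prob T w) {t : ℕ}
    (ht : t < T) (i : Fin k) (μ : Fin n → ℝ) (hμ : μ = noiseMean prob fun ω => w 1 ω 0)
    (Q : Matrix (Fin n) (Fin n) ℝ) :
    (fun a => ∫ ω, (w (t + 1) ω i - μ) a * quad Q (w (t + 1) ω i - μ) ∂prob)
      = noiseSkew prob (fun ω => w 1 ω 0) Q := by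
  funext a
  rw [noiseSkew, ← hμ]
  have hm : Measurable fun v : Fin n → ℝ => (v - μ) a * quad Q (v - μ) := by
    have h1 : Measurable fun v : Fin n → ℝ => (v - μ) a := by
      simp only [Pi.sub_apply]
      fun_prop
    exact h1.mul (measurable_quad Q (measurable_id.sub_const μ))
  exact ((hw.identDistrib ht i).comp hm).integral_eq

variable [IsProbabilityMeasure prob]

theorem DisturbanceAssumption.centeredNoise (hw : DisturbanceAssumption prob T w) {t : ℕ}
    (ht : t < T) (i : Fin k) :
    CenteredNoise prob fun ω => w (t + 1) ω i - noiseMean prob fun ω => w 1 ω 0 := by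
  have hm : Measurable fun ω => w (t + 1) ω i := (measurable_pi_apply i).comp (hw.measurable t ht)
  have hma : ∀ a, Measurable fun ω => w (t + 1) ω i a := fun a => (measurable_pi_apply a).comp hm
  have hself : Measurable fun ω => w (t + 1) ω i ⬝ᵥ w (t + 1) ω i := by
    simp only [dotProduct]
    fun_prop
  have h4 := (memLp_two_iff_integrable_sq hself.aestronglyMeasurable).2 (hw.fourth_moment t ht i)
  have h2 : SqIntegrable prob fun ω => w (t + 1) ω i :=
    sqIntegrable_of_integrable hm (h4.integrable one_le_two)
  set μ := noiseMean prob fun ω => w 1 ω 0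
  refine ⟨hm.sub_const μ, h2.sub (sqIntegrable_const μ), fun a b => ?_, fun a => ?_⟩
  · have e : (fun ω => (w (t + 1) ω i - μ) a * (w (t + 1) ω i - μ) b)
        = fun ω => w (t + 1) ω i a * w (t + 1) ω i b - μ a * w (t + 1) ω i b
          - μ b * w (t + 1) ω i a + μ a * μ b := by
      funext ω
      simp only [Pi.sub_apply]
      ring
    rw [e]
    exact (((SqIntegrable.memLp_mul_of_memLp_self hm h4 a b).sub ((h2 b).const_mul _)).sub
      ((h2 a).const_mul _)).add (memLp_const _)
  · simp only [Pi.sub_apply]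
    rw [integral_sub ((h2 a).integrable one_le_two) (integrable_const _), integral_const]
    have := ((hw.identDistrib ht i).comp (measurable_pi_apply a)).integral_eq
    simp only [Function.comp_def] at this
    simp [this, μ, noiseMean]

end Noise

section History

theorem Admissible.measurable_control (hu : Admissible prob D w u) {t : ℕ} (ht : t < D.T) :
    Measurable[histSigma D w u t] (u t) :=
  measurable_of_apply fun i => (hu t ht i).1

/-- Since `x₀` is deterministic, the noise is the only source of randomness: `u_t` is a function of
a history already generated by `w₁, …, w_t`, and `x_{t+1}` adds only `w_{t+1}`. -/
theorem Admissible.measurable_noiseSigma (hu : Admissible prob D w u) {t : ℕ} (ht : t ≤ D.T) :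
    (∀ s ≤ t, Measurable[noiseSigma D.T w t] (state D w u s)) ∧
      ∀ s < t, Measurable[noiseSigma D.T w t] (u s) := by
  induction t with
  | zero =>
    refine ⟨fun s hs => ?_, fun s hs => absurd hs (Nat.not_lt_zero s)⟩
    obtain rfl := Nat.le_zero.1 hs
    exact measurable_const
  | succ t ih =>
    obtain ⟨h1, h2⟩ := ih (Nat.le_of_succ_le ht)
    have hle := noiseSigma_mono D.T w (Nat.le_succ t)
    have hut : Measurable[noiseSigma D.T w (t + 1)] (u t) :=
      (hu.measurable_control ht).mono ((histSigma_le_of_measurable h1 h2).trans hle) le_rfl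
    have hxt : Measurable[noiseSigma D.T w (t + 1)] (state D w u t) := (h1 t le_rfl).mono hle le_rfl
    refine ⟨fun s hs => ?_, fun s hs => ?_⟩
    · rcases Nat.le_succ_iff.1 hs with hs | rfl
      · exact (h1 s hs).mono hle le_rfl
      · refine measurable_of_apply fun i => ?_
        simp only [state_succ t 0]
        exact (measurable_drift hxt hut 0 t i).add (((measurable_pi_apply i).comp
          (MeanFieldLQ.measurable_noiseSigma ht)).sub_const 0)
    · rcases Nat.lt_succ_iff_lt_or_eq.1 hs with hs | rfl
      · exact (h2 s hs).mono hle le_rfl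
      · exact hut

theorem Admissible.histSigma_le_noiseSigma (hu : Admissible prob D w u) {t : ℕ} (ht : t ≤ D.T) :
    histSigma D w u t ≤ noiseSigma D.T w t :=
  histSigma_le_of_measurable (hu.measurable_noiseSigma ht).1 (hu.measurable_noiseSigma ht).2

theorem DisturbanceAssumption.noiseSigma_le {T : ℕ} (hw : DisturbanceAssumption prob T w) (t : ℕ) :
    noiseSigma T w t ≤ mΩ :=
  iSup₂_le fun s _ => (hw.measurable s s.2).comap_le

theorem Admissible.histSigma_le (hu : Admissible prob D w u)
    (hw : DisturbanceAssumption prob D.T w) {t : ℕ} (ht : t ≤ D.T) : histSigma D w u t ≤ mΩ :=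
  (hu.histSigma_le_noiseSigma ht).trans (hw.noiseSigma_le t)

theorem Admissible.indep_histSigma (hu : Admissible prob D w u)
    (hw : DisturbanceAssumption prob D.T w) {t : ℕ} (ht : t < D.T) :
    Indep (histSigma D w u t) (MeasurableSpace.comap (w (t + 1)) inferInstance) prob := by
  have h := indep_iSup_of_disjoint (fun s : Fin D.T => (hw.measurable s s.2).comap_le)
    hw.indep_time.iIndep (S := {s : Fin D.T | (s : ℕ) < t}) (T := {⟨t, ht⟩})
    (Set.disjoint_singleton_right.2 (lt_irrefl t))
  rw [iSup_singleton] at h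
  exact indep_of_indep_of_le_left h (hu.histSigma_le_noiseSigma ht.le)

theorem Admissible.indep_noise (hu : Admissible prob D w u)
    (hw : DisturbanceAssumption prob D.T w) {t : ℕ} (ht : t < D.T) {d : Ω → Fin n → ℝ}
    (hd : Measurable[MeasurableSpace.comap (w (t + 1)) inferInstance] d) :
    Indep (histSigma D w u t) (MeasurableSpace.comap d inferInstance) prob :=
  indep_of_indep_of_le_right (hu.indep_histSigma hw ht) hd.comap_le

theorem Admissible.sqIntegrable_control (hu : Admissible prob D w u)
    (hw : DisturbanceAssumption prob D.T w) {t : ℕ} (ht : t < D.T) (i : Fin k) :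
    SqIntegrable prob fun ω => u t ω i :=
  sqIntegrable_of_integrable ((hu t ht i).1.mono (hu.histSigma_le hw ht.le) le_rfl) (hu t ht i).2

theorem Admissible.measurable_drift (hu : Admissible prob D w u) {t : ℕ} (ht : t < D.T)
    (μ : Fin n → ℝ) (i : Fin k) : Measurable[histSigma D w u t]
      fun ω => MeanFieldLQ.drift D μ t (state D w u t ω) (u t ω) i :=
  MeanFieldLQ.measurable_drift (measurable_state_histSigma le_rfl) (hu.measurable_control ht) μ t i

end History

section Moments

variable [IsProbabilityMeasure prob]

variable [NeZero k]

theorem Admissible.sqIntegrable_state (hu : Admissible prob D w u)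
    (hw : DisturbanceAssumption prob D.T w) {t : ℕ} (ht : t ≤ D.T) (i : Fin k) :
    SqIntegrable prob fun ω => state D w u t ω i := by
  induction t generalizing i with
  | zero => exact sqIntegrable_const (D.x0 i)
  | succ t ih =>
    simp only [state_succ t (noiseMean prob fun ω => w 1 ω 0)]
    exact (SqIntegrable.drift (ih (Nat.le_of_succ_le ht))
      (hu.sqIntegrable_control hw ht) _ t i).add (hw.centeredNoise ht i).sq

theorem Admissible.sqIntegrable_drift (hu : Admissible prob D w u)
    (hw : DisturbanceAssumption prob D.T w) {t : ℕ} (ht : t < D.T) (μ : Fin n → ℝ) (i : Fin k) :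
    SqIntegrable prob fun ω => MeanFieldLQ.drift D μ t (state D w u t ω) (u t ω) i :=
  SqIntegrable.drift (hu.sqIntegrable_state hw ht.le) (hu.sqIntegrable_control hw ht) μ t i

/-- Up to a constant that does not depend on the control, the expected risk cost is the expectation
of an affine quadratic function of the states. -/
theorem exists_integral_riskCost (hQ : ∀ t ≤ D.T, (D.Q t).PosSemidef)
    (hw : DisturbanceAssumption prob D.T w) {t : ℕ} (ht : t ≤ D.T) :
    ∃ c : ℝ, ∀ u : ℕ → Ω → Fin k → Fin m → ℝ, Admissible prob D w u →
      Integrable (riskCost prob D w u t) prob ∧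
      ∫ ω, riskCost prob D w u t ω ∂prob
        = ∫ ω, ∑ i, (quad (Qlam prob D (fun ω => w 1 ω 0) t) (state D w u t ω i)
            + blam prob D (fun ω => w 1 ω 0) t ⬝ᵥ state D w u t ω i) ∂prob + c := by
  set ξ := fun ω => w 1 ω 0
  cases t with
  | zero =>
    -- At time `0` the state is deterministic and there is no prediction error, so the constant
    -- cancels the adjustment at `x₀`.
    refine ⟨-∑ i, (quad (Qlam prob D ξ 0) (D.x0 i) + blam prob D ξ 0 ⬝ᵥ D.x0 i), fun u _ => ?_⟩
    have h0 : riskCost prob D w u 0 = fun _ => 0 := by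
      funext ω
      simp [riskCost, predError, state, prevSigma]
    rw [h0]
    exact ⟨integrable_const 0, by simp [state]⟩
  | succ t =>
    set μ := noiseMean prob ξ with hμ
    have hQt := transpose_eq_of_posSemidef (hQ (t + 1) ht)
    have hQl : (Qlam prob D ξ (t + 1))ᵀ = Qlam prob D ξ (t + 1) := by
      rw [Qlam, Matrix.transpose_smul, Matrix.transpose_mul, Matrix.transpose_mul, hQt,
        transpose_noiseCov, Matrix.mul_assoc]
    -- The variance of `dᵀQd`, minus the price of evaluating the `Q^λ` form at the state instead of
    -- at the drift.
    refine ⟨∑ i, (D.lam * ∫ ω, (quad (D.Q (t + 1)) (w (t + 1) ω i - μ)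
      - ∫ ω', quad (D.Q (t + 1)) (w (t + 1) ω' i - μ) ∂prob) ^ 2 ∂prob
      - ∫ ω, quad (Qlam prob D ξ (t + 1)) (w (t + 1) ω i - μ) ∂prob), fun u hu => ?_⟩
    have hd : ∀ i, CenteredNoise prob fun ω => w (t + 1) ω i - μ := hw.centeredNoise ht
    have hi := fun i : Fin k => hu.indep_noise hw ht (d := fun ω => w (t + 1) ω i - μ)
      (((measurable_pi_apply i).comp (comap_measurable (w (t + 1)))).sub_const μ)
    have hy := fun i => hu.sqIntegrable_drift hw ht μ i
    have hym := fun i => hu.measurable_drift ht μ i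
    have key := fun i => integral_sq_sub_condExp (hu.histSigma_le hw (Nat.le_of_succ_le ht)) (hd i)
      (hi i) (hym i) (hy i) hQt
    simp only [hw.noiseCov_eq ht _ μ hμ, hw.noiseSkew_eq ht _ μ hμ,
      ← state_succ t μ] at key
    have e : ∀ ω, riskCost prob D w u (t + 1) ω
        = D.lam * ∑ i, (quad (D.Q (t + 1)) (state D w u (t + 1) ω i)
          - (prob[fun ω => quad (D.Q (t + 1)) (state D w u (t + 1) ω i) | histSigma D w u t]) ω) ^ 2 :=
      fun ω => rfl
    have hrI : Integrable (riskCost prob D w u (t + 1)) prob :=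
      (integrable_finsetSum _ fun i _ => (key i).1).const_mul D.lam
    refine ⟨hrI, ?_⟩
    have hx := fun i => hu.sqIntegrable_state hw ht i
    simp only [e]
    rw [integral_const_mul, integral_finsetSum _ fun i _ => (key i).1,
      integral_finsetSum _ fun i _ => ((hx i).integrable_quad _).fun_add
        ((hx i).integrable_dotProduct _), ← Finset.sum_add_distrib, Finset.mul_sum]
    refine Finset.sum_congr rfl fun i _ => ?_
    have h1 := integral_quad_add (hi i) (hym i) (hy i) (hd i).sq (hd i).integral hQl
    have h2 := SqIntegrable.integral_dotProduct_add (hy i) (hd i).sq (hd i).integral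
      (blam prob D ξ (t + 1))
    simp only [← state_succ t μ] at h1 h2
    rw [(key i).2, integral_add ((hx i).integrable_quad _) ((hx i).integrable_dotProduct _), h1, h2]
    have h3 : ∫ ω, quad (Qlam prob D ξ (t + 1))
          (MeanFieldLQ.drift D μ t (state D w u t ω) (u t ω) i) ∂prob
        = 4 * D.lam * ∫ ω, quad (D.Q (t + 1) * noiseCov prob ξ * D.Q (t + 1))
          (MeanFieldLQ.drift D μ t (state D w u t ω) (u t ω) i) ∂prob := by
      rw [← integral_const_mul]
      simp only [Qlam, quad, Matrix.smul_mulVec, dotProduct_smul, smul_eq_mul]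
    have h4 : ∫ ω, blam prob D ξ (t + 1) ⬝ᵥ
          MeanFieldLQ.drift D μ t (state D w u t ω) (u t ω) i ∂prob
        = 4 * D.lam * ∫ ω, (D.Q (t + 1) *ᵥ noiseSkew prob ξ (D.Q (t + 1))) ⬝ᵥ
          MeanFieldLQ.drift D μ t (state D w u t ω) (u t ω) i ∂prob := by
      rw [← integral_const_mul]
      simp only [blam, smul_dotProduct, smul_eq_mul]
    rw [h3, h4]
    ring

end Moments

end MeanFieldLQ

/-! ### The closed loop and the expected total cost -/

namespace MeanFieldLQ

variable {k n m : ℕ} {Ω : Type*}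

/-- The state process controlled by the mean-field feedback. -/
noncomputable def feedbackState [MeasurableSpace Ω] (prob : Measure Ω) (D : Data k n m)
    (ξ : Ω → Fin n → ℝ) (w : ℕ → Ω → Fin k → Fin n → ℝ) : ℕ → Ω → Fin k → Fin n → ℝ
  | 0 => fun _ => D.x0
  | t + 1 => fun ω i =>
      D.A t *ᵥ feedbackState prob D ξ w t ω i
        + D.B t *ᵥ feedback prob D ξ t (feedbackState prob D ξ w t ω i)
            (meanField (feedbackState prob D ξ w t ω))
        + D.C t *ᵥ meanField (feedbackState prob D ξ w t ω) + w (t + 1) ω i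

/-- The mean-field feedback control. -/
noncomputable def feedbackControl [MeasurableSpace Ω] (prob : Measure Ω) (D : Data k n m)
    (ξ : Ω → Fin n → ℝ) (w : ℕ → Ω → Fin k → Fin n → ℝ) (t : ℕ) (ω : Ω) (i : Fin k) :
    Fin m → ℝ :=
  feedback prob D ξ t (feedbackState prob D ξ w t ω i) (meanField (feedbackState prob D ξ w t ω))

variable {D : Data k n m} {ξ : Ω → Fin n → ℝ} {w : ℕ → Ω → Fin k → Fin n → ℝ}
  {u : ℕ → Ω → Fin k → Fin m → ℝ} {x : Ω → Fin k → Fin n → ℝ} {v : Ω → Fin k → Fin m → ℝ}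

theorem measurable_feedback {ℱ mΩ : MeasurableSpace Ω} (prob : Measure Ω) (ξ : Ω → Fin n → ℝ)
    (hx : Measurable[ℱ] x) (t : ℕ) (i : Fin k) :
    Measurable[ℱ] fun ω => feedback prob D ξ t (x ω i) (meanField (x ω)) :=
  ((measurable_mulVec _ ((measurable_pi_apply i).comp hx)).add
    (measurable_mulVec _ (measurable_meanField hx))).add_const _

variable [mΩ : MeasurableSpace Ω] {prob : Measure Ω}

/-- The feedback refers to the states that it generates itself; this closes the circle for the
recursively defined closed loop. -/
theorem state_feedbackControl (t : ℕ) :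
    state D w (feedbackControl prob D ξ w) t = feedbackState prob D ξ w t := by
  induction t with
  | zero => rfl
  | succ t ih =>
    funext ω i
    rw [state, ih]
    rfl

theorem state_ae_eq_feedbackState
    (h : ∀ t < D.T, ∀ i, ∀ᵐ ω ∂prob,
      u t ω i = feedback prob D ξ t (state D w u t ω i) (meanField (state D w u t ω)))
    {t : ℕ} (ht : t ≤ D.T) : ∀ᵐ ω ∂prob, state D w u t ω = feedbackState prob D ξ w t ω := by
  induction t with
  | zero => exact .of_forall fun _ => rfl
  | succ t ih =>
    filter_upwards [ih (Nat.le_of_succ_le ht), ae_all_iff.2 (h t ht)] with ω hx hv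
    funext i
    simp only [state, feedbackState, hv i, hx]

section Integrability

theorem integrable_controlCost (hv : ∀ i, SqIntegrable prob fun ω => v ω i) (t : ℕ) :
    Integrable (fun ω => controlCost D t (v ω)) prob :=
  integrable_finsetSum _ fun i _ => (hv i).integrable_quad _

theorem integrable_stateCost (hx : ∀ i, SqIntegrable prob fun ω => x ω i) (t : ℕ) :
    Integrable (fun ω => stateCost D t (x ω)) prob :=
  integrable_finsetSum _ fun i _ =>
    ((SqIntegrable.meanField hx).integrable_quad _).add ((hx i).integrable_quad _)

variable [IsProbabilityMeasure prob]

theorem integrable_adjustment (hx : ∀ i, SqIntegrable prob fun ω => x ω i)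
    (ξ : Ω → Fin n → ℝ) (t : ℕ) : Integrable
      (fun ω => ∑ i, (quad (Qlam prob D ξ t) (x ω i) + blam prob D ξ t ⬝ᵥ x ω i)) prob :=
  integrable_finsetSum _ fun i _ => ((hx i).integrable_quad _).add ((hx i).integrable_dotProduct _)

theorem integrable_adjustedCost (hx : ∀ i, SqIntegrable prob fun ω => x ω i)
    (ξ : Ω → Fin n → ℝ) (t : ℕ) : Integrable (fun ω => adjustedCost prob D ξ t (x ω)) prob :=
  (integrable_stateCost hx t).add (integrable_adjustment hx ξ t)

theorem integrable_value (hx : ∀ i, SqIntegrable prob fun ω => x ω i) (ξ : Ω → Fin n → ℝ)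
    (t : ℕ) : Integrable (fun ω => value prob D ξ t (x ω)) prob :=
  (integrable_finsetSum _ fun i _ => (hx i).integrable_quad _).add
    ((((SqIntegrable.meanField hx).integrable_quad _).add
      ((SqIntegrable.meanField hx).integrable_dotProduct _)).const_mul _)

theorem integrable_gap (hx : ∀ i, SqIntegrable prob fun ω => x ω i)
    (hv : ∀ i, SqIntegrable prob fun ω => v ω i) (ξ : Ω → Fin n → ℝ) (t : ℕ) :
    Integrable (fun ω => gap prob D ξ t (x ω) (v ω)) prob :=
  (integrable_finsetSum _ fun i _ =>
    (((hv i).sub (SqIntegrable.meanField hv)).sub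
      (((hx i).sub (SqIntegrable.meanField hx)).mulVec _)).integrable_quad _).add
    (((((SqIntegrable.meanField hv).sub ((SqIntegrable.meanField hx).mulVec _)).sub
      (sqIntegrable_const _)).integrable_quad _).const_mul _)

theorem integral_value (hx : ∀ i, SqIntegrable prob fun ω => x ω i) (ξ : Ω → Fin n → ℝ)
    (t : ℕ) : ∫ ω, value prob D ξ t (x ω) ∂prob
      = ∑ i, ∫ ω, quad (S prob D ξ t) (x ω i) ∂prob
        + k * (∫ ω, quad (Sbar prob D ξ t - S prob D ξ t) (meanField (x ω)) ∂prob
          + ∫ ω, g prob D ξ t ⬝ᵥ meanField (x ω) ∂prob) := by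
  have h1 := fun i => (hx i).integrable_quad (S prob D ξ t)
  have h2 := (SqIntegrable.meanField hx).integrable_quad (Sbar prob D ξ t - S prob D ξ t)
  have h3 := (SqIntegrable.meanField hx).integrable_dotProduct (g prob D ξ t)
  simp only [value]
  rw [integral_add (integrable_finsetSum _ fun i _ => h1 i) ((h2.fun_add h3).const_mul _),
    integral_finsetSum _ fun i _ => h1 i, integral_const_mul, integral_add h2 h3]

theorem sqIntegrable_feedback (hx : ∀ i, SqIntegrable prob fun ω => x ω i) (ξ : Ω → Fin n → ℝ)
    (t : ℕ) (i : Fin k) :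
    SqIntegrable prob fun ω => feedback prob D ξ t (x ω i) (meanField (x ω)) :=
  (((hx i).mulVec _).add ((SqIntegrable.meanField hx).mulVec _)).add (sqIntegrable_const _)

end Integrability

variable [IsProbabilityMeasure prob] [NeZero k]

/-- The step noise is centred and independent of the drift, both per subsystem and after averaging,
so it adds only second moments of the noise, which no control influences. -/
theorem exists_integral_value_succ (h : RiskAdjusted prob D fun ω => w 1 ω 0)
    (hw : DisturbanceAssumption prob D.T w) {t : ℕ} (ht : t < D.T) :
    ∃ c : ℝ, ∀ u : ℕ → Ω → Fin k → Fin m → ℝ, Admissible prob D w u →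
      ∫ ω, value prob D (fun ω => w 1 ω 0) (t + 1) (state D w u (t + 1) ω) ∂prob
        = ∫ ω, value prob D (fun ω => w 1 ω 0) (t + 1)
            (drift D (noiseMean prob fun ω => w 1 ω 0) t (state D w u t ω) (u t ω)) ∂prob + c := by
  set ξ := fun ω => w 1 ω 0
  set μ := noiseMean prob ξ with hμ
  have hd : ∀ i, CenteredNoise prob fun ω => w (t + 1) ω i - μ := hw.centeredNoise ht
  have hS := transpose_eq_of_posSemidef (h.posSemidef_S (Nat.succ_le_of_lt ht))
  have hSb := transpose_eq_of_posSemidef (h.posSemidef_Sbar (Nat.succ_le_of_lt ht))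
  have hdiff : (Sbar prob D ξ (t + 1) - S prob D ξ (t + 1))ᵀ
      = Sbar prob D ξ (t + 1) - S prob D ξ (t + 1) := by rw [Matrix.transpose_sub, hS, hSb]
  have hdm : SqIntegrable prob fun ω => meanField fun i => w (t + 1) ω i - μ :=
    SqIntegrable.meanField fun i => (hd i).sq
  have hdm0 : ∀ a, ∫ ω, meanField (fun i => w (t + 1) ω i - μ) a ∂prob = 0 := fun a => by
    simp only [meanField, Pi.smul_apply, Finset.sum_apply, smul_eq_mul]
    rw [integral_const_mul, integral_finsetSum _ fun i _ => ((hd i).sq a).integrable one_le_two,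
      Finset.sum_eq_zero fun i _ => (hd i).integral a, mul_zero]
  refine ⟨∑ i, ∫ ω, quad (S prob D ξ (t + 1)) (w (t + 1) ω i - μ) ∂prob
    + k * ∫ ω, quad (Sbar prob D ξ (t + 1) - S prob D ξ (t + 1))
      (meanField fun i => w (t + 1) ω i - μ) ∂prob, fun u hu => ?_⟩
  have hy := fun i => hu.sqIntegrable_drift hw ht μ i
  have hym := fun i => hu.measurable_drift ht μ i
  have hnm : ∀ i, Measurable[MeasurableSpace.comap (w (t + 1)) inferInstance]
      fun ω => w (t + 1) ω i - μ := fun i =>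
    ((measurable_pi_apply i).comp (comap_measurable (w (t + 1)))).sub_const μ
  have hmean : ∀ ω, meanField (state D w u (t + 1) ω)
      = meanField (drift D μ t (state D w u t ω) (u t ω))
        + meanField fun i => w (t + 1) ω i - μ := fun ω => by
    rw [← meanField_add, ← funext fun i => state_succ t μ ω i]
  have h1 := fun i => integral_quad_add (hu.indep_noise hw ht (hnm i)) (hym i) (hy i) (hd i).sq
    (hd i).integral hS
  have h2 := integral_quad_add (hu.indep_noise hw ht
    (measurable_meanField (measurable_of_apply hnm)))
    (measurable_meanField (measurable_of_apply hym)) (SqIntegrable.meanField hy) hdm hdm0 hdiff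
  have h3 := (SqIntegrable.meanField hy).integral_dotProduct_add hdm hdm0 (g prob D ξ (t + 1))
  simp only [← state_succ t μ] at h1
  simp only [← hmean] at h2 h3
  rw [integral_value (fun i => hu.sqIntegrable_state hw ht i), integral_value hy,
    Finset.sum_congr rfl fun i _ => h1 i, Finset.sum_add_distrib, h2, h3]
  ring

theorem exists_integral_step (h : RiskAdjusted prob D fun ω => w 1 ω 0)
    (hw : DisturbanceAssumption prob D.T w) {t : ℕ} (ht : t < D.T) :
    ∃ c : ℝ, ∀ u : ℕ → Ω → Fin k → Fin m → ℝ, Admissible prob D w u →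
      ∫ ω, adjustedCost prob D (fun ω => w 1 ω 0) t (state D w u t ω) ∂prob
          + ∫ ω, controlCost D t (u t ω) ∂prob
        = ∫ ω, value prob D (fun ω => w 1 ω 0) t (state D w u t ω) ∂prob
          - ∫ ω, value prob D (fun ω => w 1 ω 0) (t + 1) (state D w u (t + 1) ω) ∂prob
          + ∫ ω, gap prob D (fun ω => w 1 ω 0) t (state D w u t ω) (u t ω) ∂prob + c := by
  obtain ⟨c₁, hc₁⟩ := exists_integral_value_succ h hw ht
  obtain ⟨c₂, hc₂⟩ := h.dynamic_programming ht
  refine ⟨c₁ + c₂, fun u hu => ?_⟩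
  set ξ := fun ω => w 1 ω 0
  have hx := hu.sqIntegrable_state hw ht.le
  have hv := hu.sqIntegrable_control hw ht
  have hy := hu.sqIntegrable_drift hw ht (noiseMean prob ξ)
  have i1 := integrable_adjustedCost (D := D) hx ξ t
  have i2 := integrable_controlCost (D := D) hv t
  have i3 := integrable_value (D := D) hy ξ (t + 1)
  have i4 := integrable_value (D := D) hx ξ t
  have i5 := integrable_gap (D := D) hx hv ξ t
  have e := integral_congr_ae (μ := prob)
    (.of_forall fun ω => hc₂ (state D w u t ω) (u t ω))
  rw [integral_add (i1.fun_add i2) i3, integral_add i1 i2,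
    integral_add (i4.fun_add i5) (integrable_const _), integral_add i4 i5, integral_const] at e
  simp only [probReal_univ, one_smul] at e
  rw [hc₁ u hu]
  linarith

/-- Up to a constant that does not depend on the control, the expected total cost is the sum of the
expected excess costs. -/
theorem exists_integral_totalCost (h : RiskAdjusted prob D fun ω => w 1 ω 0)
    (hw : DisturbanceAssumption prob D.T w) :
    ∃ c : ℝ, ∀ u : ℕ → Ω → Fin k → Fin m → ℝ, Admissible prob D w u →
      Integrable (totalCost prob D w u) prob ∧
      ∫ ω, totalCost prob D w u ω ∂prob
        = ∑ t ∈ Finset.range D.T,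
            ∫ ω, gap prob D (fun ω => w 1 ω 0) t (state D w u t ω) (u t ω) ∂prob + c := by
  set ξ := fun ω => w 1 ω 0
  -- The constants are chosen before the control, hence are common to all admissible controls.
  choose! c hc using fun (t : ℕ) (ht : t ≤ D.T) => exists_integral_riskCost h.posQ hw ht
  choose! c' hc' using fun (t : ℕ) (ht : t < D.T) => exists_integral_step h hw ht
  refine ⟨value prob D ξ 0 D.x0 + c D.T + ∑ t ∈ Finset.range D.T, (c t + c' t), fun u hu => ?_⟩
  have hx : ∀ t ≤ D.T, ∀ i, SqIntegrable prob fun ω => state D w u t ω i :=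
    fun t ht => hu.sqIntegrable_state hw ht
  have iS : ∀ t ≤ D.T,
      Integrable (fun ω => stateCost D t (state D w u t ω) + riskCost prob D w u t ω) prob :=
    fun t ht => (integrable_stateCost (hx t ht) t).add (hc t ht u hu).1
  have iC : ∀ t < D.T, Integrable (fun ω => controlCost D t (u t ω)) prob :=
    fun t ht => integrable_controlCost (hu.sqIntegrable_control hw ht) t
  have iSum : ∀ t ∈ Finset.range D.T, Integrable (fun ω => stateCost D t (state D w u t ω)
      + riskCost prob D w u t ω + controlCost D t (u t ω)) prob := fun t ht =>
    (iS t (Finset.mem_range.1 ht).le).add (iC t (Finset.mem_range.1 ht))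
  have eS : ∀ t ≤ D.T, ∫ ω, (stateCost D t (state D w u t ω) + riskCost prob D w u t ω) ∂prob
      = ∫ ω, adjustedCost prob D ξ t (state D w u t ω) ∂prob + c t := fun t ht => by
    simp only [adjustedCost]
    rw [integral_add (integrable_stateCost (hx t ht) t) (hc t ht u hu).1, (hc t ht u hu).2,
      integral_add (integrable_stateCost (hx t ht) t) (integrable_adjustment (hx t ht) ξ t),
      add_assoc]
  refine ⟨(iS D.T le_rfl).add (integrable_finsetSum _ iSum), ?_⟩
  have e0 : ∫ ω, value prob D ξ 0 (state D w u 0 ω) ∂prob = value prob D ξ 0 D.x0 := by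
    simp [state]
  have eT : ∫ ω, adjustedCost prob D ξ D.T (state D w u D.T ω) ∂prob
      = ∫ ω, value prob D ξ D.T (state D w u D.T ω) ∂prob := by simp only [value_terminal]
  have eSum : ∀ t ∈ Finset.range D.T, ∫ ω, (stateCost D t (state D w u t ω)
      + riskCost prob D w u t ω + controlCost D t (u t ω)) ∂prob
      = (∫ ω, value prob D ξ t (state D w u t ω) ∂prob
          - ∫ ω, value prob D ξ (t + 1) (state D w u (t + 1) ω) ∂prob)
        + ∫ ω, gap prob D ξ t (state D w u t ω) (u t ω) ∂prob + (c t + c' t) := fun t ht => by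
    have ht := Finset.mem_range.1 ht
    rw [integral_add (iS t ht.le) (iC t ht), eS t ht.le]
    linarith [hc' t ht u hu]
  simp only [totalCost]
  -- The expected values telescope: the one at `T` cancels the terminal cost, and the one at `0` is
  -- deterministic.
  rw [integral_add (iS D.T le_rfl) (integrable_finsetSum _ iSum), integral_finsetSum _ iSum,
    Finset.sum_congr rfl eSum, Finset.sum_add_distrib, Finset.sum_add_distrib,
    Finset.sum_range_sub' fun t => ∫ ω, value prob D ξ t (state D w u t ω) ∂prob, eS D.T le_rfl,
    eT, e0]
  ring

/-- Proved directly along the closed loop, because `Admissible.sqIntegrable_state` presupposes the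
admissibility that this lemma serves to establish. -/
theorem sqIntegrable_feedbackState (hw : DisturbanceAssumption prob D.T w) (ξ : Ω → Fin n → ℝ)
    {t : ℕ} (ht : t ≤ D.T) (i : Fin k) :
    SqIntegrable prob fun ω => feedbackState prob D ξ w t ω i := by
  induction t generalizing i with
  | zero => exact sqIntegrable_const (D.x0 i)
  | succ t ih =>
    have hx := ih (Nat.le_of_succ_le ht)
    simp only [← state_feedbackControl (D := D) (w := w) (t + 1),
      state_succ t (noiseMean prob fun ω => w 1 ω 0), state_feedbackControl t]
    exact (SqIntegrable.drift hx (sqIntegrable_feedback hx ξ t) _ t i).add (hw.centeredNoise ht i).sq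

theorem admissible_feedbackControl (hw : DisturbanceAssumption prob D.T w)
    (ξ : Ω → Fin n → ℝ) : Admissible prob D w (feedbackControl prob D ξ w) := fun t ht i => by
  refine ⟨?_, (sqIntegrable_feedback (sqIntegrable_feedbackState hw ξ ht.le) ξ t i).integrable_self⟩
  simp only [feedbackControl, ← state_feedbackControl t]
  exact measurable_feedback prob ξ (measurable_state_histSigma le_rfl) t i

end MeanFieldLQ

/-- The common law of the disturbances enters through `w 1 · 0`, the disturbance of the first
subsystem at time `1`. -/
theorem theorem2 {k n m : ℕ} [NeZero k] {Ω : Type*} [MeasurableSpace Ω]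
    (prob : Measure Ω) [IsProbabilityMeasure prob]
    (D : MeanFieldLQ.Data k n m) (hT : 0 < D.T) (hlam : 0 ≤ D.lam)
    (hP : ∀ t ≤ D.T, (D.P t).PosSemidef)
    (hQ : ∀ t ≤ D.T, (D.Q t).PosSemidef)
    (hR : ∀ t < D.T, (D.R t).PosDef)
    (w : ℕ → Ω → Fin k → Fin n → ℝ)
    (hw : MeanFieldLQ.DisturbanceAssumption prob D.T w) :
    -- the expected cost of every admissible control is finite
    (∀ u : ℕ → Ω → Fin k → Fin m → ℝ, MeanFieldLQ.Admissible prob D w u →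
      Integrable (MeanFieldLQ.totalCost prob D w u) prob) ∧
    -- the matrices inverted in the recursions are invertible
    (∀ t < D.T,
      IsUnit (MeanFieldLQ.pivot (D.B t) (D.R t)
        (MeanFieldLQ.S prob D (fun ω => w 1 ω 0) (t + 1))) ∧
      IsUnit (MeanFieldLQ.pivot (D.B t) (D.R t)
        (MeanFieldLQ.Sbar prob D (fun ω => w 1 ω 0) (t + 1)))) ∧
    -- the mean-field feedback control is optimal, and it is the only optimal control
    ∃ u : ℕ → Ω → Fin k → Fin m → ℝ,
      (∀ t < D.T, ∀ (i : Fin k) (ω : Ω),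
        u t ω i =
          MeanFieldLQ.K prob D (fun ω' => w 1 ω' 0) t *ᵥ MeanFieldLQ.state D w u t ω i
          + (MeanFieldLQ.Kbar prob D (fun ω' => w 1 ω' 0) t
              - MeanFieldLQ.K prob D (fun ω' => w 1 ω' 0) t) *ᵥ
              MeanFieldLQ.meanField (MeanFieldLQ.state D w u t ω)
          + MeanFieldLQ.f prob D (fun ω' => w 1 ω' 0) t) ∧
      MeanFieldLQ.IsOptimal prob D w u ∧
      ∀ v : ℕ → Ω → Fin k → Fin m → ℝ, MeanFieldLQ.IsOptimal prob D w v →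
        ∀ t < D.T, ∀ i : Fin k, (fun ω => v t ω i) =ᵐ[prob] (fun ω => u t ω i) := by
  set ξ : Ω → Fin n → ℝ := fun ω => w 1 ω 0
  have h : MeanFieldLQ.RiskAdjusted prob D ξ :=
    ⟨hP, hQ, hR, fun t ht =>
      MeanFieldLQ.posSemidef_Qlam (hw.centeredNoise hT 0).sq hlam (hQ t ht)⟩
  obtain ⟨c, hc⟩ := MeanFieldLQ.exists_integral_totalCost h hw
  have hadm := MeanFieldLQ.admissible_feedbackControl hw ξ
  -- All gaps of the feedback vanish, so its cost is the constant `c`, the lower bound for every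
  -- admissible control.
  have hcost : ∫ ω, MeanFieldLQ.totalCost prob D w (MeanFieldLQ.feedbackControl prob D ξ w) ω ∂prob
      = c := by
    rw [(hc _ hadm).2, Finset.sum_eq_zero, zero_add]
    intro t _
    simp only [MeanFieldLQ.state_feedbackControl]
    exact integral_eq_zero_of_ae (.of_forall fun ω => MeanFieldLQ.gap_feedback fun i => rfl)
  have hnn : ∀ v : ℕ → Ω → Fin k → Fin m → ℝ, ∀ t ∈ Finset.range D.T,
      0 ≤ ∫ ω, MeanFieldLQ.gap prob D ξ t (MeanFieldLQ.state D w v t ω) (v t ω) ∂prob :=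
    fun v t ht => integral_nonneg fun ω => h.gap_nonneg (Finset.mem_range.1 ht) _ _
  refine ⟨fun u hu => (hc u hu).1,
    fun t ht => ⟨(h.posDef_pivot_S ht).isUnit, (h.posDef_pivot_Sbar ht).isUnit⟩,
    MeanFieldLQ.feedbackControl prob D ξ w, fun t _ i ω => ?_, ⟨hadm, fun v hv => ?_⟩,
    fun v hv t ht i => ?_⟩
  · rw [MeanFieldLQ.state_feedbackControl]
    rfl
  · rw [hcost, (hc v hv).2]
    linarith [Finset.sum_nonneg (hnn v)]
  · have hle := hv.2 _ hadm
    rw [hcost, (hc v hv.1).2] at hle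
    have hzero : ∑ t ∈ Finset.range D.T,
        ∫ ω, MeanFieldLQ.gap prob D ξ t (MeanFieldLQ.state D w v t ω) (v t ω) ∂prob = 0 :=
      le_antisymm (by linarith) (Finset.sum_nonneg (hnn v))
    -- The expected gaps are nonnegative with sum zero, so each gap vanishes almost surely and the
    -- optimal `v` obeys the feedback law at its own states.
    have hfb : ∀ t < D.T, ∀ i, ∀ᵐ ω ∂prob, v t ω i = MeanFieldLQ.feedback prob D ξ t
        (MeanFieldLQ.state D w v t ω i) (MeanFieldLQ.meanField (MeanFieldLQ.state D w v t ω)) := by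
      intro t ht i
      have h0 := (Finset.sum_eq_zero_iff_of_nonneg (hnn v)).1 hzero t (Finset.mem_range.2 ht)
      have hint := MeanFieldLQ.integrable_gap (D := D) (hv.1.sqIntegrable_state hw ht.le)
        (hv.1.sqIntegrable_control hw ht) ξ t
      filter_upwards [(integral_eq_zero_iff_of_nonneg (fun ω => h.gap_nonneg ht _ _) hint).1 h0]
        with ω hω
      exact h.eq_feedback_of_gap_eq_zero ht hω i
    filter_upwards [hfb t ht i, MeanFieldLQ.state_ae_eq_feedbackState hfb ht.le] with ω h1 h2
    rw [h1, h2]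
    rfl
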